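/- Let $d \ge 3$ be an integer, and for every integer $N$ with $N \ge d+1$ and $Nd$ even let $\mathcal G_N$ be a uniformly random simple $d$-regular graph on the vertex set $\{1,\dots,N\}$, with adjacency matrix $A_N$. Let $g_1,\dots,g_N$ be i.i.d. Gaussian random variables with mean zero and variance one, independent of $\mathcal G_N$, and let $V_N=\mathrm{diag}(g_1,\dots,g_N)$. For $t>0$ and $z = E+\mathrm i\eta$ with $E\in\mathbb R$ and $\eta>0$, let $$W_{N,t} = -tA_N+V_N,\qquad G(z) = (W_{N,t}-z)^{-1}.$$ Fix $s\in(0,\infty)$, $t>0$ and an integer $d\ge 3$. There exists a constant $C=C(d,s,t)>1$ such that for all $N \ge d+1$ with $Nd$ even, all $E\in\mathbb R$ and all $\eta\ge(\log N)^{-1}$, with $z=E+\mathrm i\eta$, the random variable $(\operatorname{Im}G_{11}(z))^s$ is integrable and $$\mathbb P\left(\left|\frac1N\sum_{j=1}^N\big(\operatorname{Im}G_{jj}(z)\big)^s-\mathbb E\Big[\big(\operatorname{Im}G_{11}(z)\big)^s\Big]\right|\le\eta\right)\ge 1-C\,N^{-100}.$$ -/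

import Mathlib

open MeasureTheory ProbabilityTheory

noncomputable section

namespace TightBinding

open Classical in
/-- The set of simple `d`-regular graphs on the vertex set `Fin N`. -/
def regularGraphs (d N : ℕ) : Set (SimpleGraph (Fin N)) :=
  {𝒢 | 𝒢.IsRegularOfDegree d}

/-- The joint law of `(𝒢_N, (g_1, …, g_N))`: a uniformly random simple `d`-regular graph on `N`
vertices and, independently of it, `N` i.i.d. Gaussian variables with mean `0` and variance `1`.
It is a probability measure as soon as a simple `d`-regular graph on `N` vertices exists, that is,
when `N ≥ d + 1` and `N * d` is even. -/
def law (d N : ℕ) : Measure (SimpleGraph (Fin N) × (Fin N → ℝ)) :=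
  (uniformOn (regularGraphs d N)).prod (Measure.pi fun _ : Fin N => gaussianReal 0 1)

open Classical in
/-- The tight-binding matrix `W_{N,t} = -t A_N + V_N`, where `A_N` is the adjacency matrix of the
graph and `V_N = diag(g_1, …, g_N)`. -/
def hamiltonian {N : ℕ} (t : ℝ) (ω : SimpleGraph (Fin N) × (Fin N → ℝ)) :
    Matrix (Fin N) (Fin N) ℝ :=
  (-t) • ω.1.adjMatrix ℝ + Matrix.diagonal ω.2

/-- The resolvent `G_N(z) = (W_{N,t} - z)⁻¹`. As `W_{N,t}` is real symmetric, the matrix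
`W_{N,t} - z` is invertible for every non-real `z`. -/
def resolvent {N : ℕ} (t : ℝ) (z : ℂ) (ω : SimpleGraph (Fin N) × (Fin N → ℝ)) :
    Matrix (Fin N) (Fin N) ℂ :=
  ((hamiltonian t ω).map Complex.ofReal - z • (1 : Matrix (Fin N) (Fin N) ℂ))⁻¹

/-- The random variable `(Im G_{jj}(z))^s`. -/
def imDiagPow {N : ℕ} (t s : ℝ) (z : ℂ) (j : Fin N)
    (ω : SimpleGraph (Fin N) × (Fin N → ℝ)) : ℝ :=
  ((resolvent t z ω j j).im) ^ s

end TightBinding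

end

/-!
The average `F = N⁻¹ ∑ⱼ (Im Gⱼⱼ)ˢ` is concentrated because no single source of randomness
moves it by more than `N⁻¹` times a power of `log N`, while `η ≥ 1 / log N` leaves a lot of room.

* *Resolvent.* Since `0 ≤ Im Gⱼⱼ ≤ 1 / η ≤ log N`, the power `xˢ` may be replaced by
  `truncPow s ε`, which is Lipschitz with a constant polynomial in `log N`, at a cost of at most
  `η / 4`.
  Changing one potential value `gᵢ` by an arbitrary amount changes the diagonal of `G` by at most
  `1 / η` in total (`sum_norm_green_add_single_sub_le`), and changing a bounded number of edges
  changes it by `O(1 / η²)` (`sum_norm_green_sub_le`). Both follow from the Ward identity.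
* *Potential.* For a fixed graph, bounded differences give concentration around the average over the
  potential, the function `quenched` of the graph (`hasSubgaussianMGF_pi`).
* *Graph.* A regular graph is a random pairing of half-edges, encoded by a uniform permutation,
  conditioned to be simple. Functions of a uniform permutation which are Lipschitz under
  transpositions have Gaussian tails at scale `exp (-N / polylog N)` (`sum_perm_exp_le`), and the
  pairing is simple with at least polynomially small probability
  (`card_perm_le_card_defect_eq_zero`): the expected number of loops and parallel edges is bounded,
  and each of them can be removed by one switching, which has at most `(N d)²` inverses. Every
  regular graph comes from the same number of permutations (`card_represents`). Hence `quenched` is also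
  concentrated for the uniform regular graph (`card_regular_mul_card_perm_le`).

The typical value thus obtained is close to the expectation of `F`, as `F` is bounded by a power of
`log N`, and the expectation of `F` is that of `(Im G₁₁)ˢ`, by exchangeability of the vertices
(`integral_imDiagPow_eq`). For the finitely many small `N` the constant `C` makes the bound void.
-/

namespace TightBinding

/-! ### Concentration for functions of a uniformly random permutation -/

lemma exp_le_cosh_add_mul {x B : ℝ} (hB : 0 < B) (hx : |x| ≤ B) :
    Real.exp x ≤ Real.cosh B + x * (Real.sinh B / B) := by
  obtain ⟨h1, h2⟩ := abs_le.mp hx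
  have h := convexOn_exp.2 (Set.mem_univ B) (Set.mem_univ (-B))
    (show 0 ≤ (B + x) / (2 * B) from div_nonneg (by linarith) (by linarith))
    (show 0 ≤ (B - x) / (2 * B) from div_nonneg (by linarith) (by linarith))
    (by field_simp; ring)
  have e1 : ((B + x) / (2 * B)) • B + ((B - x) / (2 * B)) • (-B) = x := by
    simp only [smul_eq_mul]; field_simp; ring
  rw [e1] at h
  refine h.trans (le_of_eq ?_)
  rw [Real.cosh_eq, Real.sinh_eq]
  simp only [smul_eq_mul]; field_simp; ring

/-- **Hoeffding's lemma** for the uniform measure on a finite type. -/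
lemma sum_exp_le_of_sum_eq_zero {α : Type*} [Fintype α] (X : α → ℝ) {B : ℝ} (hB : 0 ≤ B)
    (hX : ∀ a, |X a| ≤ B) (h0 : ∑ a, X a = 0) :
    ∑ a, Real.exp (X a) ≤ Fintype.card α * Real.exp (B ^ 2 / 2) := by
  rcases hB.eq_or_lt with rfl | hB
  · have : ∀ a, X a = 0 := fun a => abs_nonpos_iff.mp (hX a)
    simp [this]
  · calc ∑ a, Real.exp (X a) ≤ ∑ a, (Real.cosh B + X a * (Real.sinh B / B)) :=
          Finset.sum_le_sum fun a _ => exp_le_cosh_add_mul hB (hX a)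
      _ = Fintype.card α * Real.cosh B := by
          rw [Finset.sum_add_distrib, ← Finset.sum_mul, h0]; simp
      _ ≤ _ := by gcongr; exact Real.cosh_le_exp_half_sq B

/-- The average of `f` over a finite type. -/
noncomputable def avg {α : Type*} [Fintype α] (f : α → ℝ) : ℝ := (∑ a, f a) / Fintype.card α

lemma card_mul_avg {α : Type*} [Fintype α] [Nonempty α] (f : α → ℝ) :
    Fintype.card α * avg f = ∑ a, f a := by
  unfold avg; field_simp

lemma abs_avg_sub_avg_le {α : Type*} [Fintype α] [Nonempty α] (f g : α → ℝ) {c : ℝ}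
    (h : ∀ a, |f a - g a| ≤ c) : |avg f - avg g| ≤ c := by
  have hc : (0 : ℝ) < Fintype.card α := by exact_mod_cast Fintype.card_pos
  rw [avg, avg, ← sub_div, ← Finset.sum_sub_distrib, abs_div, abs_of_pos hc, div_le_iff₀ hc]
  refine (Finset.abs_sum_le_sum_abs _ _).trans ((Finset.sum_le_sum fun a _ => h a).trans ?_)
  simp [mul_comm]

lemma decomposeFin_symm_eq_swap_mul {n : ℕ} (p : Fin (n + 1)) (e : Equiv.Perm (Fin n)) :
    Equiv.Perm.decomposeFin.symm (p, e)
      = Equiv.swap 0 p * Equiv.Perm.decomposeFin.symm (0, e) := by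
  ext x
  refine Fin.cases ?_ (fun i => ?_) x <;> simp

lemma decomposeFin_symm_mul_swap {n : ℕ} (p : Fin (n + 1)) (e : Equiv.Perm (Fin n))
    (a b : Fin n) :
    Equiv.Perm.decomposeFin.symm (p, e * Equiv.swap a b)
      = Equiv.Perm.decomposeFin.symm (p, e) * Equiv.swap a.succ b.succ := by
  ext x
  refine Fin.cases ?_ (fun i => ?_) x
  · rw [Equiv.Perm.mul_apply, Equiv.swap_apply_of_ne_of_ne (Fin.succ_ne_zero a).symm
      (Fin.succ_ne_zero b).symm]
    simp
  · rw [Equiv.Perm.mul_apply, (Fin.succ_injective n).swap_apply]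
    simp

/-- Exponential moment bound for a function on permutations which moves by at most `c` under a
transposition. Choosing the image of one point at a time costs one application of Hoeffding's
lemma per point: two choices of the image differ by two transpositions. -/
theorem sum_perm_fin_exp_le {n : ℕ} (f : Equiv.Perm (Fin n) → ℝ) {c : ℝ} (hc0 : 0 ≤ c)
    (hc : ∀ σ a b, |f (σ * Equiv.swap a b) - f σ| ≤ c) (θ : ℝ) :
    ∑ σ, Real.exp (θ * (f σ - avg f))
      ≤ Fintype.card (Equiv.Perm (Fin n)) * Real.exp (n * (2 * (θ * c) ^ 2)) := by
  induction n with
  | zero =>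
    have : ∀ σ, f σ - avg f = 0 := fun σ => by
      simp [avg, Subsingleton.elim σ default]
    simp [this]
  | succ n ih =>
    set D := (Equiv.Perm.decomposeFin (n := n)).symm
    set h : Fin (n + 1) → ℝ := fun p => avg fun e => f (D (p, e)) with hh
    have hsum : ∀ F : Equiv.Perm (Fin (n + 1)) → ℝ, ∑ σ, F σ = ∑ p, ∑ e, F (D (p, e)) :=
      fun F => by rw [← Fintype.sum_prod_type', ← Equiv.sum_comp D]
    have hcard : (Fintype.card (Equiv.Perm (Fin (n + 1))) : ℝ)
        = (n + 1) * Fintype.card (Equiv.Perm (Fin n)) := by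
      rw [Fintype.card_congr (Equiv.Perm.decomposeFin (n := n))]; simp
    have havg : avg f = avg h := by
      have h1 : ∑ p, h p = (∑ σ, f σ) / Fintype.card (Equiv.Perm (Fin n)) := by
        rw [hsum, Finset.sum_div]; rfl
      rw [avg, avg, h1, hcard, div_div]; simp [mul_comm]
    have hleft : ∀ σ a b, |f (Equiv.swap a b * σ) - f σ| ≤ c := fun σ a b => by
      rw [Equiv.swap_mul_eq_mul_swap]; exact hc _ _ _
    have hdiff : ∀ p q, |h p - h q| ≤ 2 * c := fun p q => by
      refine abs_avg_sub_avg_le _ _ fun e => ?_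
      have hp := hleft (D (0, e)) 0 p
      have hq := hleft (D (0, e)) 0 q
      have ep : D (p, e) = Equiv.swap 0 p * D (0, e) := decomposeFin_symm_eq_swap_mul p e
      have eq : D (q, e) = Equiv.swap 0 q * D (0, e) := decomposeFin_symm_eq_swap_mul q e
      rw [ep, eq, abs_le] at *
      constructor <;> linarith [hp.1, hp.2, hq.1, hq.2]
    have hdev : ∀ p, |h p - avg h| ≤ 2 * c := fun p => by
      have e1 : avg (fun _ : Fin (n + 1) => h p) = h p := by
        simp [avg]; field_simp
      rw [← e1]
      exact abs_avg_sub_avg_le _ _ fun q => hdiff p q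
    have hH : ∑ p, Real.exp (θ * (h p - avg h)) ≤ (n + 1) * Real.exp (2 * (θ * c) ^ 2) := by
      have := sum_exp_le_of_sum_eq_zero (fun p => θ * (h p - avg h)) (B := |θ| * (2 * c))
        (by positivity)
        (fun p => by rw [abs_mul]; exact mul_le_mul_of_nonneg_left (hdev p) (abs_nonneg θ))
        (by
          rw [← Finset.mul_sum, Finset.sum_sub_distrib, ← card_mul_avg h]
          simp)
      refine this.trans (le_of_eq ?_)
      simp only [Fintype.card_fin, Nat.cast_add, Nat.cast_one]
      congr 2
      rw [mul_pow, sq_abs]; ring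
    calc ∑ σ, Real.exp (θ * (f σ - avg f))
        = ∑ p, Real.exp (θ * (h p - avg h)) * ∑ e, Real.exp (θ * (f (D (p, e)) - h p)) := by
          rw [hsum, havg]
          refine Finset.sum_congr rfl fun p _ => ?_
          rw [Finset.mul_sum]
          refine Finset.sum_congr rfl fun e _ => ?_
          rw [← Real.exp_add]; congr 1; ring
      _ ≤ ∑ p, Real.exp (θ * (h p - avg h)) *
            (Fintype.card (Equiv.Perm (Fin n)) * Real.exp (n * (2 * (θ * c) ^ 2))) := by
          refine Finset.sum_le_sum fun p _ => ?_
          refine mul_le_mul_of_nonneg_left ?_ (Real.exp_pos _).le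
          refine ih (fun e => f (D (p, e))) fun σ a b => ?_
          have := decomposeFin_symm_mul_swap p σ a b
          simp only [D, this]
          exact hc _ _ _
      _ ≤ (n + 1) * Real.exp (2 * (θ * c) ^ 2) *
            (Fintype.card (Equiv.Perm (Fin n)) * Real.exp (n * (2 * (θ * c) ^ 2))) := by
          rw [← Finset.sum_mul]; gcongr
      _ = _ := by
          rw [hcard, Nat.cast_succ, add_mul _ _ (2 * (θ * c) ^ 2), Real.exp_add, one_mul]; ring

theorem sum_perm_exp_le {α : Type*} [Fintype α] [DecidableEq α] (f : Equiv.Perm α → ℝ) {c : ℝ}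
    (hc0 : 0 ≤ c) (hc : ∀ σ a b, |f (σ * Equiv.swap a b) - f σ| ≤ c) (θ : ℝ) :
    ∑ σ, Real.exp (θ * (f σ - avg f))
      ≤ Fintype.card (Equiv.Perm α) * Real.exp (Fintype.card α * (2 * (θ * c) ^ 2)) := by
  let ε := (Fintype.equivFin α).symm
  let T : Equiv.Perm (Fin (Fintype.card α)) ≃ Equiv.Perm α := ε.permCongr
  have hT : ∀ σ a b, T (σ * Equiv.swap a b) = T σ * Equiv.swap (ε a) (ε b) := fun σ a b => by
    ext x
    simp only [T, Equiv.permCongr_apply, Equiv.Perm.mul_apply]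
    congr 2
    rw [Equiv.eq_symm_apply, ← ε.injective.swap_apply, Equiv.apply_symm_apply]
  have hcard := Fintype.card_congr T
  have havg : avg (fun σ => f (T σ)) = avg f := by
    rw [avg, avg, hcard, Equiv.sum_comp T f]
  have := sum_perm_fin_exp_le (fun σ => f (T σ)) hc0
    (fun σ a b => by simp only [hT]; exact hc _ _ _) θ
  rw [havg, Equiv.sum_comp T (fun σ => Real.exp (θ * (f σ - avg f))), hcard] at this
  exact this

lemma card_le_of_sum_exp_le {α : Type*} [Fintype α] (X : α → ℝ) {θ l A : ℝ} (hθ : 0 ≤ θ)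
    (h : ∑ a, Real.exp (θ * X a) ≤ A) :
    (Nat.card {a // l ≤ X a} : ℝ) ≤ A * Real.exp (-(θ * l)) := by
  classical
  rw [Nat.card_eq_fintype_card, Fintype.card_subtype, Real.exp_neg, ← div_eq_mul_inv,
    le_div_iff₀ (Real.exp_pos _)]
  refine le_trans ?_ h
  rw [← nsmul_eq_mul, ← Finset.sum_const]
  refine (Finset.sum_le_sum fun a ha => ?_).trans
    (Finset.sum_le_sum_of_subset_of_nonneg (Finset.filter_subset (fun a => l ≤ X a) _)
      fun a _ _ => (Real.exp_pos _).le)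
  exact Real.exp_le_exp.mpr (mul_le_mul_of_nonneg_left (Finset.mem_filter.mp ha).2 hθ)

/-- Chernoff's bound for functions of a uniform permutation. -/
theorem card_perm_abs_sub_avg_ge_le {α : Type*} [Fintype α] [DecidableEq α] [Nonempty α]
    (f : Equiv.Perm α → ℝ) {c l : ℝ} (hc0 : 0 < c) (hl : 0 ≤ l)
    (hc : ∀ σ a b, |f (σ * Equiv.swap a b) - f σ| ≤ c) :
    (Nat.card {σ // l ≤ |f σ - avg f|} : ℝ)
      ≤ 2 * Fintype.card (Equiv.Perm α) * Real.exp (-(l ^ 2 / (8 * Fintype.card α * c ^ 2))) := by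
  classical
  have hn : (0 : ℝ) < Fintype.card α := by exact_mod_cast Fintype.card_pos
  set n : ℝ := (Fintype.card α : ℝ)
  -- the minimizer of `2 n θ² c² - θ l`
  set θ : ℝ := l / (4 * n * c ^ 2) with hθ
  have hθ0 : 0 ≤ θ := by positivity
  have hexp : n * (2 * (θ * c) ^ 2) + -(θ * l) = -(l ^ 2 / (8 * n * c ^ 2)) := by
    rw [hθ]; field_simp; ring
  have h1 := card_le_of_sum_exp_le (l := l) (fun σ => f σ - avg f) hθ0
    (sum_perm_exp_le f hc0.le hc θ)
  have h2 := card_le_of_sum_exp_le (l := l) (fun σ => -(f σ - avg f)) hθ0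
    (A := Fintype.card (Equiv.Perm α) * Real.exp (n * (2 * (θ * c) ^ 2))) (by
      have := sum_perm_exp_le f hc0.le hc (-θ)
      simpa only [neg_mul, mul_neg, neg_sq] using this)
  rw [mul_assoc, ← Real.exp_add, hexp] at h1 h2
  have h3 : Nat.card {σ // l ≤ |f σ - avg f|}
      ≤ Nat.card {σ // l ≤ f σ - avg f} + Nat.card {σ // l ≤ -(f σ - avg f)} := by
    simp only [Nat.card_eq_fintype_card, le_abs]
    exact Fintype.card_subtype_or _ _
  have h4 : (Nat.card {σ // l ≤ |f σ - avg f|} : ℝ)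
      ≤ Nat.card {σ // l ≤ f σ - avg f} + Nat.card {σ // l ≤ -(f σ - avg f)} := by
    exact_mod_cast h3
  linarith

/-! ### Bounded differences under a product measure -/

lemma integrable_of_measurable_of_abs_le {Ω : Type*} [MeasurableSpace Ω] {μ : Measure Ω}
    [IsFiniteMeasure μ] {f : Ω → ℝ} {K : ℝ} (hf : Measurable f) (hK : ∀ x, |f x| ≤ K) :
    Integrable f μ :=
  Integrable.of_bound hf.aestronglyMeasurable K (.of_forall hK)

/-- If the sections `f (x, ·)` and the partial mean `x ↦ ∫ f (x, y) dy` are both sub-Gaussian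
after centering, then so is `f`, and the parameters add up. -/
lemma hasSubgaussianMGF_prod {X Y : Type*} [MeasurableSpace X] [MeasurableSpace Y]
    {μ : Measure X} {ν : Measure Y} [IsProbabilityMeasure μ] [IsProbabilityMeasure ν]
    {f : X × Y → ℝ} {K : ℝ} {c₁ c₂ : NNReal} (hf : Measurable f) (hK : ∀ p, |f p| ≤ K)
    (h₁ : HasSubgaussianMGF (fun x => (∫ y, f (x, y) ∂ν) - ∫ x, ∫ y, f (x, y) ∂ν ∂μ) c₁ μ)
    (h₂ : ∀ x, HasSubgaussianMGF (fun y => f (x, y) - ∫ y, f (x, y) ∂ν) c₂ ν) :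
    HasSubgaussianMGF (fun p => f p - ∫ q, f q ∂(μ.prod ν)) (c₁ + c₂) (μ.prod ν) := by
  have hfi : Integrable f (μ.prod ν) := integrable_of_measurable_of_abs_le hf hK
  have hexp : ∀ t : ℝ, Integrable (fun p => Real.exp (t * (f p - ∫ q, f q ∂(μ.prod ν))))
      (μ.prod ν) := fun t => by
    refine integrable_of_measurable_of_abs_le
      (K := Real.exp (|t| * (K + |∫ q, f q ∂(μ.prod ν)|))) (by fun_prop) fun p => ?_
    rw [abs_of_pos (Real.exp_pos _)]
    refine Real.exp_le_exp.mpr ((le_abs_self _).trans ?_)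
    rw [abs_mul]
    refine mul_le_mul_of_nonneg_left ((abs_sub _ _).trans ?_) (abs_nonneg _)
    gcongr
    exact hK p
  refine ⟨hexp, fun t => ?_⟩
  rw [mgf, integral_prod _ (hexp t), integral_prod f hfi]
  set m := ∫ x, ∫ y, f (x, y) ∂ν ∂μ
  calc ∫ x, ∫ y, Real.exp (t * (f (x, y) - m)) ∂ν ∂μ
      = ∫ x, Real.exp (t * ((∫ y, f (x, y) ∂ν) - m)) *
          mgf (fun y => f (x, y) - ∫ y, f (x, y) ∂ν) ν t ∂μ := by
        refine integral_congr_ae (.of_forall fun x => ?_)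
        simp only [mgf]
        rw [← integral_const_mul]
        refine integral_congr_ae (.of_forall fun y => ?_)
        simp only
        rw [← Real.exp_add]; congr 1; ring
    _ ≤ ∫ x, Real.exp (t * ((∫ y, f (x, y) ∂ν) - m)) * Real.exp (c₂ * t ^ 2 / 2) ∂μ := by
        refine integral_mono_of_nonneg (.of_forall fun x => ?_) ?_ (.of_forall fun x => ?_)
        · exact mul_nonneg (Real.exp_pos _).le mgf_nonneg
        · exact (h₁.integrable_exp_mul t).mul_const _
        · exact mul_le_mul_of_nonneg_left ((h₂ x).mgf_le t) (Real.exp_pos _).le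
    _ ≤ Real.exp (c₁ * t ^ 2 / 2) * Real.exp (c₂ * t ^ 2 / 2) := by
        rw [integral_mul_const]
        exact mul_le_mul_of_nonneg_right (h₁.mgf_le t) (Real.exp_pos _).le
    _ = _ := by rw [← Real.exp_add]; congr 1; push_cast; ring

/-- **McDiarmid's inequality** in its sub-Gaussian form, with a non-optimal constant. -/
theorem hasSubgaussianMGF_pi {E : Type*} [MeasurableSpace E] (μ : Measure E)
    [IsProbabilityMeasure μ] {n : ℕ} (f : (Fin n → E) → ℝ) {K : ℝ} (c : NNReal)
    (hf : Measurable f) (hK : ∀ x, |f x| ≤ K)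
    (hc : ∀ x i y, |f (Function.update x i y) - f x| ≤ c) :
    HasSubgaussianMGF (fun x => f x - ∫ x, f x ∂(Measure.pi fun _ : Fin n => μ)) (n * c ^ 2)
      (Measure.pi fun _ : Fin n => μ) := by
  induction n with
  | zero =>
    have : ∀ x, f x - ∫ x, f x ∂(Measure.pi fun _ : Fin 0 => μ) = 0 := fun x => by
      simp [Measure.pi_of_empty _ x]
    simp only [this]
    simp [HasSubgaussianMGF.fun_zero (μ := Measure.pi fun _ : Fin 0 => μ)]
  | succ n ih =>
    obtain ⟨x₀⟩ : Nonempty E := nonempty_of_isProbabilityMeasure μ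
    have hmp := measurePreserving_piFinSuccAbove (fun _ : Fin (n + 1) => μ) 0
    set T := MeasurableEquiv.piFinSuccAbove (fun _ : Fin (n + 1) => E) 0
    set ν := Measure.pi fun _ : Fin n => μ
    set F : E × (Fin n → E) → ℝ := fun p => f (T.symm p) with hF
    have hTs : ∀ x y, T.symm (x, y) = Fin.cons x y := fun x y => by
      simp [T, MeasurableEquiv.piFinSuccAbove, Fin.insertNthEquiv]
    have hFm : Measurable F := hf.comp T.symm.measurable
    have hFK : ∀ p, |F p| ≤ K := fun p => hK _
    have hfst : ∀ x x' y, |F (x, y) - F (x', y)| ≤ c := fun x x' y => by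
      have := hc (Fin.cons x' y) 0 x
      rwa [Fin.update_cons_zero, ← hTs, ← hTs] at this
    have hsec : ∀ x y i z, |F (x, Function.update y i z) - F (x, y)| ≤ c := fun x y i z => by
      have := hc (Fin.cons x y) i.succ z
      rwa [← Fin.cons_update, ← hTs, ← hTs] at this
    have hint : ∀ x, Integrable (fun y => F (x, y)) ν := fun x =>
      integrable_of_measurable_of_abs_le (hFm.comp measurable_prodMk_left) fun y => hFK _
    have h1 : HasSubgaussianMGF (fun x => (∫ y, F (x, y) ∂ν) - ∫ x, ∫ y, F (x, y) ∂ν ∂μ)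
        (c ^ 2) μ := by
      have hm : Measurable fun x => ∫ y, F (x, y) ∂ν :=
        (hFm.stronglyMeasurable.integral_prod_right (f := fun x y => F (x, y))).measurable
      have := hasSubgaussianMGF_of_mem_Icc (μ := μ) (X := fun x => ∫ y, F (x, y) ∂ν)
        (a := (∫ y, F (x₀, y) ∂ν) - c) (b := (∫ y, F (x₀, y) ∂ν) + c) hm.aemeasurable
        (.of_forall fun x => by
          have : |(∫ y, F (x, y) ∂ν) - ∫ y, F (x₀, y) ∂ν| ≤ c := by
            rw [← integral_sub (hint x) (hint x₀)]
            have := norm_integral_le_of_norm_le_const (μ := ν) (C := c)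
              (f := fun y => F (x, y) - F (x₀, y)) (.of_forall fun y => hfst x x₀ y)
            simpa using this
          rw [abs_le] at this
          constructor <;> linarith)
      convert this using 2
      ext
      push_cast
      rw [Real.norm_eq_abs, abs_of_nonneg] <;> ring_nf
      have := c.2
      positivity
    have h2 : ∀ x, HasSubgaussianMGF (fun y => F (x, y) - ∫ y, F (x, y) ∂ν) (n * c ^ 2) ν :=
      fun x => ih (fun y => F (x, y)) (hFm.comp measurable_prodMk_left) (fun y => hFK _)
        (fun y i z => hsec x y i z)
    have h3 := hasSubgaussianMGF_prod hFm hFK h1 h2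
    have h4 : HasSubgaussianMGF ((fun p => F p - ∫ q, F q ∂(μ.prod ν)) ∘ T) (c ^ 2 + n * c ^ 2)
        (Measure.pi fun _ : Fin (n + 1) => μ) := by
      refine HasSubgaussianMGF.of_map hmp.measurable.aemeasurable ?_
      rw [hmp.map_eq]; exact h3
    have h5 : ∫ q, F q ∂(μ.prod ν) = ∫ x, f x ∂(Measure.pi fun _ : Fin (n + 1) => μ) := by
      rw [← hmp.integral_comp T.measurableEmbedding]
      simp [hF]
    have h6 : (fun p => F p - ∫ q, F q ∂(μ.prod ν)) ∘ T
        = fun x => f x - ∫ x, f x ∂(Measure.pi fun _ : Fin (n + 1) => μ) := by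
      funext x; rw [Function.comp, h5]; simp [hF]
    rw [h6] at h4
    convert h4 using 1
    push_cast; ring

theorem measureReal_abs_sub_integral_ge_le {E : Type*} [MeasurableSpace E] (μ : Measure E)
    [IsProbabilityMeasure μ] {n : ℕ} (f : (Fin n → E) → ℝ) {K c l : ℝ} (hl : 0 ≤ l)
    (hc0 : 0 ≤ c) (hf : Measurable f) (hK : ∀ x, |f x| ≤ K)
    (hc : ∀ x i y, |f (Function.update x i y) - f x| ≤ c) :
    (Measure.pi fun _ : Fin n => μ).real
        {x | l ≤ |f x - ∫ x, f x ∂(Measure.pi fun _ : Fin n => μ)|}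
      ≤ 2 * Real.exp (-(l ^ 2 / (2 * (n * c ^ 2)))) := by
  lift c to NNReal using hc0
  have h := hasSubgaussianMGF_pi μ f c hf hK hc
  set m := ∫ x, f x ∂(Measure.pi fun _ : Fin n => μ)
  have h1 := h.measure_ge_le hl
  have h2 := h.neg.measure_ge_le hl
  have h3 : {x | l ≤ |f x - m|} ⊆ {x | l ≤ f x - m} ∪ {x | l ≤ (-fun x => f x - m) x} :=
    fun x hx => by simpa [le_abs] using hx
  refine (measureReal_mono h3).trans ((measureReal_union_le _ _).trans ?_)
  push_cast at h1 h2
  rw [neg_div] at h1 h2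
  linarith

/-! ### Resolvents of real symmetric matrices -/

section Resolvent

open Matrix

variable {n : Type*} [DecidableEq n]

/-- The matrix `W - z` with complex entries, for a real matrix `W`. -/
noncomputable def shifted (z : ℂ) (W : Matrix n n ℝ) : Matrix n n ℂ :=
  W.map Complex.ofReal - z • (1 : Matrix n n ℂ)

variable {z : ℂ} {W W' : Matrix n n ℝ}

lemma shifted_conjTranspose (hW : W.IsSymm) :
    (shifted z W)ᴴ = shifted z W + (2 * z.im * Complex.I) • (1 : Matrix n n ℂ) := by
  have hz : (starRingEnd ℂ) z = z - 2 * z.im * Complex.I := by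
    apply Complex.ext <;> simp; ring
  ext i j
  have h := hW.apply i j
  by_cases hij : i = j
  · subst hij
    simp [shifted, Matrix.conjTranspose_apply, hz]; ring
  · simp [shifted, Matrix.conjTranspose_apply, h, Matrix.one_apply_ne hij,
      Matrix.one_apply_ne (Ne.symm hij)]

variable [Fintype n]

/-- The resolvent `(W - z)⁻¹` of a real matrix `W`. -/
noncomputable def green (z : ℂ) (W : Matrix n n ℝ) : Matrix n n ℂ := (shifted z W)⁻¹

open scoped ComplexOrder in
/-- For real symmetric `W` the kernel of `W - z` is trivial: on it, `v* (W - z) v` and its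
conjugate differ by `2 i (Im z) ‖v‖²`. -/
lemma isUnit_det_shifted (hW : W.IsSymm) (hz : 0 < z.im) : IsUnit (shifted z W).det := by
  rw [isUnit_iff_ne_zero]
  intro h0
  obtain ⟨v, hv0, hv⟩ := Matrix.exists_mulVec_eq_zero_iff.mpr h0
  have h1 : star v ⬝ᵥ ((shifted z W)ᴴ *ᵥ v) = 0 := by
    rw [Matrix.dotProduct_mulVec, ← Matrix.star_mulVec, hv]; simp
  rw [shifted_conjTranspose hW, Matrix.add_mulVec, hv, zero_add, Matrix.smul_mulVec,
    Matrix.one_mulVec, dotProduct_smul, smul_eq_mul, mul_eq_zero] at h1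
  rcases h1 with h1 | h1
  · simp [hz.ne'] at h1
  · exact hv0 (dotProduct_star_self_eq_zero.mp h1)

lemma shifted_mul_green (hW : W.IsSymm) (hz : 0 < z.im) : shifted z W * green z W = 1 :=
  Matrix.mul_nonsing_inv _ (isUnit_det_shifted hW hz)

lemma green_mul_shifted (hW : W.IsSymm) (hz : 0 < z.im) : green z W * shifted z W = 1 :=
  Matrix.nonsing_inv_mul _ (isUnit_det_shifted hW hz)

lemma green_apply_comm (hW : W.IsSymm) (i j : n) : green z W i j = green z W j i := by
  have h : (shifted z W)ᵀ = shifted z W := by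
    ext a b
    simp [shifted, hW.apply a b, Matrix.one_apply, eq_comm]
  have h2 : (green z W)ᵀ = green z W := by
    rw [green, Matrix.transpose_nonsing_inv, h]
  exact congrFun (congrFun h2 j) i

/-- The **resolvent identity**. -/
lemma green_sub_green (hW : W.IsSymm) (hW' : W'.IsSymm) (hz : 0 < z.im) :
    green z W' - green z W = green z W * (W - W').map Complex.ofReal * green z W' := by
  have h : (W - W').map Complex.ofReal = shifted z W - shifted z W' := by
    ext i j; simp [shifted]
  rw [h, mul_sub, sub_mul, green_mul_shifted hW hz, one_mul, Matrix.mul_assoc,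
    shifted_mul_green hW' hz, mul_one]

/-- The **Ward identity**. -/
lemma im_mul_sum_sq_green (hW : W.IsSymm) (hz : 0 < z.im) (j : n) :
    z.im * ∑ k, ‖green z W j k‖ ^ 2 = (green z W j j).im := by
  have h1 : green z W - (green z W)ᴴ
      = (2 * z.im * Complex.I) • (green z W * (green z W)ᴴ) := by
    have h2 : (shifted z W)ᴴ * (green z W)ᴴ = 1 := by
      rw [← Matrix.conjTranspose_mul, green_mul_shifted hW hz, Matrix.conjTranspose_one]
    have h3 : green z W * (shifted z W)ᴴ * (green z W)ᴴ = green z W := by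
      rw [Matrix.mul_assoc, h2, mul_one]
    rw [shifted_conjTranspose hW, mul_add, add_mul, green_mul_shifted hW hz, one_mul] at h3
    nth_rewrite 1 [← h3]
    simp
  have h4 := congrArg Complex.im (congrFun (congrFun h1 j) j)
  have h5 : (green z W * (green z W)ᴴ) j j = ((∑ k, ‖green z W j k‖ ^ 2 : ℝ) : ℂ) := by
    rw [Matrix.mul_apply]
    push_cast
    refine Finset.sum_congr rfl fun k _ => ?_
    rw [Matrix.conjTranspose_apply, Complex.star_def, Complex.mul_conj']
  rw [Matrix.sub_apply, Matrix.smul_apply, h5, Matrix.conjTranspose_apply, Complex.star_def,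
    Complex.sub_im, Complex.conj_im, smul_eq_mul, mul_comm, Complex.im_ofReal_mul] at h4
  have h6 : (2 * (z.im : ℂ) * Complex.I).im = 2 * z.im := by simp
  rw [h6] at h4
  linarith

lemma im_green_nonneg (hW : W.IsSymm) (hz : 0 < z.im) (j : n) : 0 ≤ (green z W j j).im := by
  rw [← im_mul_sum_sq_green hW hz]; positivity

lemma norm_green_le (hW : W.IsSymm) (hz : 0 < z.im) (j : n) : ‖green z W j j‖ ≤ 1 / z.im := by
  have h1 := im_mul_sum_sq_green hW hz j
  have h2 : ‖green z W j j‖ ^ 2 ≤ ∑ k, ‖green z W j k‖ ^ 2 :=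
    Finset.single_le_sum (f := fun k => ‖green z W j k‖ ^ 2) (fun k _ => by positivity)
      (Finset.mem_univ j)
  have h3 := (le_abs_self _).trans (Complex.abs_im_le_norm (green z W j j))
  rw [le_div_iff₀ hz]
  by_contra! h4
  have h5 : 0 < ‖green z W j j‖ := by
    by_contra! h; nlinarith [norm_nonneg (green z W j j)]
  nlinarith [mul_le_mul_of_nonneg_left h2 hz.le]

lemma im_green_le (hW : W.IsSymm) (hz : 0 < z.im) (j : n) : (green z W j j).im ≤ 1 / z.im :=
  ((le_abs_self _).trans (Complex.abs_im_le_norm _)).trans (norm_green_le hW hz j)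

lemma sum_sq_green_le (hW : W.IsSymm) (hz : 0 < z.im) (j : n) :
    ∑ k, ‖green z W j k‖ ^ 2 ≤ 1 / z.im ^ 2 := by
  have h1 := im_mul_sum_sq_green hW hz j
  have h2 := im_green_le hW hz j
  rw [← h1, le_div_iff₀ hz] at h2
  rw [le_div_iff₀ (by positivity)]
  linarith

lemma sum_norm_green_mul_le (hW : W.IsSymm) (hW' : W'.IsSymm) (hz : 0 < z.im) (a b : n) :
    ∑ j, ‖green z W a j‖ * ‖green z W' b j‖ ≤ 1 / z.im ^ 2 := by
  have h : ∀ j, ‖green z W a j‖ * ‖green z W' b j‖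
      ≤ (‖green z W a j‖ ^ 2 + ‖green z W' b j‖ ^ 2) / 2 := fun j => by
    nlinarith [sq_nonneg (‖green z W a j‖ - ‖green z W' b j‖)]
  refine (Finset.sum_le_sum fun j _ => h j).trans ?_
  rw [← Finset.sum_div, Finset.sum_add_distrib]
  linarith [sum_sq_green_le hW hz a, sum_sq_green_le hW' hz b]

theorem sum_norm_green_sub_le (hW : W.IsSymm) (hW' : W'.IsSymm) (hz : 0 < z.im) :
    ∑ j, ‖green z W' j j - green z W j j‖ ≤ (∑ a, ∑ b, |W a b - W' a b|) / z.im ^ 2 := by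
  have h1 : ∀ j, ‖green z W' j j - green z W j j‖
      ≤ ∑ a, ∑ b, |W a b - W' a b| * (‖green z W a j‖ * ‖green z W' b j‖) := fun j => by
    have h := congrFun (congrFun (green_sub_green hW hW' hz) j) j
    rw [Matrix.sub_apply] at h
    rw [h, Matrix.mul_apply, Finset.sum_comm]
    refine (norm_sum_le _ _).trans (Finset.sum_le_sum fun b _ => ?_)
    rw [norm_mul, Matrix.mul_apply]
    refine (mul_le_mul_of_nonneg_right (norm_sum_le _ _) (norm_nonneg _)).trans ?_
    rw [Finset.sum_mul]
    refine Finset.sum_le_sum fun a _ => le_of_eq ?_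
    rw [norm_mul, green_apply_comm hW j a, Matrix.map_apply, Complex.norm_real, Real.norm_eq_abs,
      Matrix.sub_apply]
    ring
  refine (Finset.sum_le_sum fun j _ => h1 j).trans ?_
  rw [Finset.sum_comm, div_eq_mul_one_div, Finset.sum_mul]
  refine Finset.sum_le_sum fun a _ => ?_
  rw [Finset.sum_comm, Finset.sum_mul]
  refine Finset.sum_le_sum fun b _ => ?_
  rw [← Finset.mul_sum]
  exact mul_le_mul_of_nonneg_left (sum_norm_green_mul_le hW hW' hz a b) (abs_nonneg _)

/-- A perturbation of one diagonal entry changes the diagonal of the resolvent by a bounded total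
amount, however large the perturbation `δ` is. -/
theorem sum_norm_green_add_single_sub_le (hW : W.IsSymm) (hz : 0 < z.im) (e : n) (δ : ℝ)
    (hW' : W' = W + Matrix.single e e δ) :
    ∑ j, ‖green z W' j j - green z W j j‖ ≤ 1 / z.im := by
  have hS' : W'.IsSymm := by
    rw [hW']; refine hW.add ?_
    simp [Matrix.IsSymm]
  have hE : (W - W').map Complex.ofReal = Matrix.single e e (-(δ : ℂ)) := by
    rw [hW', sub_add_cancel_left]
    ext i j
    simp only [Matrix.map_apply, Matrix.neg_apply, Matrix.single, Matrix.of_apply]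
    split_ifs <;> simp
  have hdiff : ∀ i j, green z W' i j - green z W i j
      = -(δ : ℂ) * green z W i e * green z W' e j := fun i j => by
    have h := congrFun (congrFun (green_sub_green hW hS' hz) i) j
    rw [Matrix.sub_apply, hE, Matrix.mul_apply, Finset.sum_eq_single e] at h
    · rw [h, Matrix.mul_single_apply_same]; ring
    · intro b _ hb
      rw [Matrix.mul_single_apply_of_ne _ _ _ _ _ hb, zero_mul]
    · simp
  set g := green z W e e
  set g' := green z W' e e
  have hcol : ∀ j, green z W' j e = green z W j e * (1 - δ * g') := fun j => by
    linear_combination hdiff j e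
  have hone : (1 - δ * g') * (1 + δ * g) = 1 := by
    linear_combination (-(δ : ℂ)) * hdiff e e
  have him : |δ| * g.im ≤ ‖1 + δ * g‖ := by
    have := Complex.abs_im_le_norm (1 + δ * g)
    simp only [Complex.add_im, Complex.one_im, Complex.im_ofReal_mul, zero_add, abs_mul] at this
    rwa [abs_of_nonneg (im_green_nonneg hW hz e)] at this
  have hterm : ∀ j, ‖green z W' j j - green z W j j‖
      = |δ| * ‖1 - δ * g'‖ * ‖green z W e j‖ ^ 2 := fun j => by
    rw [hdiff, green_apply_comm hS' e j, hcol, norm_mul, norm_mul, norm_mul, norm_neg,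
      Complex.norm_real, Real.norm_eq_abs, green_apply_comm hW j e]
    ring
  simp only [hterm]
  rw [← Finset.mul_sum, le_div_iff₀ hz, mul_assoc, mul_comm _ z.im, im_mul_sum_sq_green hW hz]
  calc |δ| * ‖1 - δ * g'‖ * g.im = (|δ| * g.im) * ‖1 - δ * g'‖ := by ring
    _ ≤ ‖1 + δ * g‖ * ‖1 - δ * g'‖ := by gcongr
    _ = 1 := by rw [← norm_mul, mul_comm, hone, norm_one]

lemma measurable_green {Ω : Type*} [MeasurableSpace Ω] {W : Ω → Matrix n n ℝ}
    (hW : ∀ i j, Measurable fun ω => W ω i j) (i j : n) :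
    Measurable fun ω => green z (W ω) i j := by
  have h1 : ∀ i j, Measurable fun ω => shifted z (W ω) i j := fun i j => by
    simp only [shifted, Matrix.sub_apply, Matrix.map_apply]
    exact (Complex.measurable_ofReal.comp (hW i j)).sub measurable_const
  have hdet : ∀ M : Ω → Matrix n n ℂ, (∀ i j, Measurable fun ω => M ω i j) →
      Measurable fun ω => (M ω).det := fun M hM => by
    simp only [Matrix.det_apply]
    exact Finset.measurable_fun_sum _ fun σ _ =>
      (Finset.measurable_fun_prod _ fun k _ => hM _ _).const_smul _
  simp only [green, Matrix.inv_def, Matrix.smul_apply, Ring.inverse_eq_inv', smul_eq_mul,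
    Matrix.adjugate_apply]
  refine (hdet _ h1).inv.mul (hdet _ fun a b => ?_)
  by_cases h : a = j
  · subst h; simp
  · simpa [Matrix.updateRow_ne h] using h1 a b

lemma green_reindex {m : Type*} [Fintype m] [DecidableEq m] (e : m ≃ n) (i j : m) :
    green z (W.submatrix e e) i j = green z W (e i) (e j) := by
  have : shifted z (W.submatrix e e) = (shifted z W).submatrix e e := by
    ext a b; simp [shifted, Matrix.one_apply]
  rw [green, this, Matrix.inv_submatrix_equiv]; rfl

end Resolvent

/-! ### A Lipschitz approximation of the power function -/

/-- The function `x ^ s` with its argument truncated from below at `ε`, which makes it Lipschitz on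
bounded intervals also when `s < 1`. -/
noncomputable def truncPow (s ε x : ℝ) : ℝ := (max x ε) ^ s

section TruncPow

variable {s ε x y l : ℝ}

lemma measurable_truncPow : Measurable (truncPow s ε) := by
  unfold truncPow; fun_prop

lemma abs_truncPow_sub_le (hs : 0 < s) (hε : 0 ≤ ε) (hx : 0 ≤ x) :
    |truncPow s ε x - x ^ s| ≤ ε ^ s := by
  unfold truncPow
  rcases le_total x ε with h | h
  · rw [max_eq_right h, abs_of_nonneg (sub_nonneg.mpr (Real.rpow_le_rpow hx h hs.le))]
    linarith [Real.rpow_nonneg hx s]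
  · rw [max_eq_left h, sub_self, abs_zero]; positivity

lemma truncPow_nonneg (hε : 0 < ε) : 0 ≤ truncPow s ε x :=
  Real.rpow_nonneg (hε.le.trans (le_max_right _ _)) _

lemma truncPow_le (hs : 0 < s) (hε : 0 < ε) (hεl : ε ≤ l) (hx : x ≤ l) :
    truncPow s ε x ≤ l ^ s :=
  Real.rpow_le_rpow (hε.le.trans (le_max_right _ _)) (max_le hx hεl) hs.le

lemma abs_truncPow_sub_truncPow_le (hs : 0 < s) (hε : 0 < ε) (hεl : ε ≤ l) (hx : x ≤ l)
    (hy : y ≤ l) : |truncPow s ε x - truncPow s ε y| ≤ s * l ^ s / ε * |x - y| := by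
  have hl := hε.trans_le hεl
  have h := Convex.norm_image_sub_le_of_norm_hasDerivWithin_le (f := fun u : ℝ => u ^ s)
    (f' := fun u => s * u ^ (s - 1)) (s := Set.Icc ε l) (C := s * l ^ s / ε)
    (x := max y ε) (y := max x ε)
    (fun u hu => (Real.hasDerivAt_rpow_const (Or.inl (hε.trans_le hu.1).ne')).hasDerivWithinAt)
    (fun u hu => by
      have hu0 := hε.trans_le hu.1
      rw [Real.norm_eq_abs, abs_of_nonneg (by positivity), Real.rpow_sub_one hu0.ne', mul_div_assoc]
      gcongr
      exacts [hu.2, hu.1])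
    (convex_Icc ε l) ⟨le_max_right _ _, max_le hy hεl⟩ ⟨le_max_right _ _, max_le hx hεl⟩
  refine h.trans (mul_le_mul_of_nonneg_left ?_ (by positivity))
  exact abs_max_sub_max_le_abs x y ε

end TruncPow

/-! ### Pairings of half-edges -/

section Pairing

open Finset

variable {I V : Type*}

/-- For a labelling `w` of half-edges by vertices and an involution `bar` which pairs the
half-edges, the oriented edge from the vertex of `p` to the vertex of its partner. -/
def dart (bar : Equiv.Perm I) (w : I → V) (p : I) : V × V := (w p, w (bar p))

variable {bar : Equiv.Perm I} {v w : I → V} {d : ℕ}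

/-- The simple graph underlying the multigraph. -/
def pairGraph (bar : Equiv.Perm I) (hb : ∀ p, bar (bar p) = p) (w : I → V) : SimpleGraph V where
  Adj a b := a ≠ b ∧ ∃ p, dart bar w p = (a, b)
  symm := ⟨fun a b ⟨hab, p, hp⟩ => ⟨hab.symm, bar p, by
    simp only [dart, Prod.mk.injEq, hb] at hp ⊢; exact ⟨hp.2, hp.1⟩⟩⟩
  loopless := ⟨fun _ h => h.1 rfl⟩

lemma dart_bar (hb : ∀ p, bar (bar p) = p) (p : I) :
    dart bar w (bar p) = (dart bar w p).swap := by
  simp [dart, hb]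

variable [Fintype I] [DecidableEq V]

lemma card_fiber_comp (hv : ∀ x, #{p | v p = x} = d) (σ : Equiv.Perm I) (x : V) :
    #{p | (v ∘ σ) p = x} = d := by
  rw [← hv x]
  exact card_equiv σ fun q => by simp

/-- The adjacency matrix of the multigraph. -/
def pairMatrix (bar : Equiv.Perm I) (w : I → V) : Matrix V V ℝ :=
  Matrix.of fun a b => ∑ p, if dart bar w p = (a, b) then 1 else 0

lemma pairMatrix_isSymm (hb : ∀ p, bar (bar p) = p) : (pairMatrix bar w).IsSymm := by
  ext a b
  simp only [pairMatrix, Matrix.transpose_apply, Matrix.of_apply]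
  refine Fintype.sum_equiv bar _ _ fun p => ?_
  rw [dart_bar hb]
  simp [Prod.ext_iff, and_comm]

variable [DecidableEq I]

/-- The number of pairs of distinct half-edges with the same oriented edge. A loop and a pair of
parallel edges both contribute, so the defect vanishes exactly when the multigraph is simple. -/
def defect (bar : Equiv.Perm I) (w : I → V) : ℕ :=
  #{x : I × I | x.1 ≠ x.2 ∧ dart bar w x.1 = dart bar w x.2}

lemma defect_eq_zero_iff : defect bar w = 0 ↔ Function.Injective (dart bar w) := by
  rw [defect, card_eq_zero, filter_eq_empty_iff]
  constructor
  · intro h p q hpq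
    by_contra hne
    exact h (mem_univ (p, q)) ⟨hne, hpq⟩
  · rintro h ⟨p, q⟩ _ ⟨hne, hpq⟩
    exact hne (h hpq)

/-! ### The expected defect of a random pairing -/

/-- All positions `b` outside `S` are exchangeable for `Q`, and at most `d` of them share the vertex
of `a`. -/
lemma card_sdiff_mul_card_filter_le (hv : ∀ x, #{p | v p = x} = d) (S : Finset I) {a b : I}
    (ha : a ∈ S) (hbS : b ∉ S) (Q : Equiv.Perm I → Prop) [DecidablePred Q]
    (hQ : ∀ σ, ∀ b' ∉ S, Q (σ * Equiv.swap b b') ↔ Q σ) :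
    (Fintype.card I - #S) * #{σ : Equiv.Perm I | v (σ a) = v (σ b) ∧ Q σ}
      ≤ d * #{σ : Equiv.Perm I | Q σ} := by
  have hex : ∀ b' ∈ Sᶜ, #{σ : Equiv.Perm I | v (σ a) = v (σ b') ∧ Q σ}
      = #{σ : Equiv.Perm I | v (σ a) = v (σ b) ∧ Q σ} := fun b' hb' => by
    rw [mem_compl] at hb'
    refine card_equiv (Equiv.mulRight (Equiv.swap b b')) fun σ => ?_
    have h1 : Equiv.swap b b' a = a := Equiv.swap_apply_of_ne_of_ne
      (fun h => hbS (h ▸ ha)) (fun h => hb' (h ▸ ha))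
    simp [hQ σ b' hb', h1]
  have hsum : (Fintype.card I - #S) * #{σ : Equiv.Perm I | v (σ a) = v (σ b) ∧ Q σ}
      = ∑ b' ∈ Sᶜ, #{σ : Equiv.Perm I | v (σ a) = v (σ b') ∧ Q σ} := by
    rw [sum_congr rfl hex, sum_const, card_compl, smul_eq_mul]
  rw [hsum]
  simp only [card_filter]
  rw [sum_comm, mul_sum]
  refine sum_le_sum fun σ _ => ?_
  by_cases hσ : Q σ
  · simp only [hσ, and_true, if_true, mul_one]
    rw [← card_filter, ← hv (v (σ a))]
    refine card_le_card_of_injOn σ (fun b' hb' => ?_) σ.injective.injOn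
    simp only [coe_filter, Set.mem_ofPred_eq, mem_univ, true_and] at hb' ⊢
    exact hb'.2.symm
  · simp [hσ]

/-- The mean defect is bounded independently of the number of half-edges. Two distinct half-edges
share their vertex with probability `O(d / n)`, and two disjoint such coincidences occur together
with probability `O(d² / n²)`. -/
lemma sum_defect_le (hb : ∀ p, bar (bar p) = p) (hne : ∀ p, bar p ≠ p)
    (hv : ∀ x, #{p | v p = x} = d) (hn : 6 ≤ Fintype.card I) :
    ∑ σ : Equiv.Perm I, defect bar (v ∘ σ)
      ≤ (2 * d + 4 * d ^ 2) * Fintype.card (Equiv.Perm I) := by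
  set n := Fintype.card I with hndef
  set T := Fintype.card (Equiv.Perm I) with hT
  have hone : ∀ p q, p ≠ q → n * #{σ : Equiv.Perm I | v (σ p) = v (σ q)} ≤ 2 * d * T :=
    fun p q hpq => by
      have h := card_sdiff_mul_card_filter_le hv {p} (a := p) (b := q) (by simp)
        (by simpa using hpq.symm) (fun _ => True) (by simp)
      simp only [and_true, filter_true, card_univ, card_singleton, ← hndef, ← hT] at h
      have : n ≤ 2 * (n - 1) := by omega
      calc _ ≤ 2 * (n - 1) * #{σ : Equiv.Perm I | v (σ p) = v (σ q)} := by gcongr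
        _ ≤ 2 * (d * T) := by rw [mul_assoc]; gcongr
        _ = _ := by ring
  have htwo : ∀ x : I × I, n ^ 2 *
      #{σ : Equiv.Perm I | x.1 ≠ x.2 ∧ dart bar (v ∘ σ) x.1 = dart bar (v ∘ σ) x.2}
        ≤ (if x.2 = bar x.1 then n * (2 * d * T) else 0) + 4 * d ^ 2 * T := by
    rintro ⟨p, q⟩
    by_cases hpq : p = q
    · simp [hpq]
    simp only [ne_eq, hpq, not_false_eq_true, true_and, dart, Prod.mk.injEq, Function.comp]
    by_cases hq : q = bar p
    · rw [if_pos hq]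
      have h1 := hone p q hpq
      have h2 : #{σ : Equiv.Perm I | v (σ p) = v (σ q) ∧ v (σ (bar p)) = v (σ (bar q))}
          ≤ #{σ : Equiv.Perm I | v (σ p) = v (σ q)} :=
        card_le_card (monotone_filter_right _ fun σ _ h => h.1)
      calc _ ≤ n ^ 2 * #{σ : Equiv.Perm I | v (σ p) = v (σ q)} := by gcongr
        _ = n * (n * #{σ : Equiv.Perm I | v (σ p) = v (σ q)}) := by ring
        _ ≤ n * (2 * d * T) := by gcongr
        _ ≤ _ := Nat.le_add_right _ _
    · rw [if_neg hq, zero_add]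
      have hpbq : p ≠ bar q := fun h => hq (by rw [h, hb])
      have hcard : #({p, bar p, bar q} : Finset I) = 3 :=
        card_eq_three.mpr ⟨p, bar p, bar q, (hne p).symm, hpbq, bar.injective.ne hpq, rfl⟩
      have h1 := hone (bar p) (bar q) (bar.injective.ne hpq)
      have h2 := card_sdiff_mul_card_filter_le hv {p, bar p, bar q} (a := p) (b := q) (by simp)
        (by simp [Ne.symm hpq, hq, (hne q).symm])
        (fun σ => v (σ (bar p)) = v (σ (bar q))) (fun σ b' hb' => by
          simp only [mem_insert, mem_singleton, not_or] at hb'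
          rw [Equiv.Perm.mul_apply, Equiv.Perm.mul_apply,
            Equiv.swap_apply_of_ne_of_ne (Ne.symm hq) (Ne.symm hb'.2.1),
            Equiv.swap_apply_of_ne_of_ne (hne q) (Ne.symm hb'.2.2)])
      rw [hcard, ← hndef] at h2
      have h3 : n ≤ 2 * (n - 3) := by omega
      calc _ = n * (n *
              #{σ : Equiv.Perm I | v (σ p) = v (σ q) ∧ v (σ (bar p)) = v (σ (bar q))}) := by
            ring
        _ ≤ n * (2 * (n - 3) *
              #{σ : Equiv.Perm I | v (σ p) = v (σ q) ∧ v (σ (bar p)) = v (σ (bar q))}) := by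
            gcongr
        _ ≤ n * (2 * (d * #{σ : Equiv.Perm I | v (σ (bar p)) = v (σ (bar q))})) := by
            rw [mul_assoc 2]; gcongr
        _ = 2 * d * (n * #{σ : Equiv.Perm I | v (σ (bar p)) = v (σ (bar q))}) := by ring
        _ ≤ 2 * d * (2 * d * T) := by gcongr
        _ = _ := by ring
  have hsw : ∑ σ : Equiv.Perm I, defect bar (v ∘ σ) = ∑ x : I × I,
      #{σ : Equiv.Perm I | x.1 ≠ x.2 ∧ dart bar (v ∘ σ) x.1 = dart bar (v ∘ σ) x.2} := by
    simp only [defect, card_filter]; rw [sum_comm]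
  have hdiag : ∑ x : I × I, (if x.2 = bar x.1 then n * (2 * d * T) else 0)
      = n * (n * (2 * d * T)) := by
    rw [Fintype.sum_prod_type]
    simp [← hndef]
  have hfin : n ^ 2 * ∑ σ : Equiv.Perm I, defect bar (v ∘ σ)
      ≤ n ^ 2 * ((2 * d + 4 * d ^ 2) * T) := by
    rw [hsw, mul_sum]
    refine (sum_le_sum fun x _ => htwo x).trans (le_of_eq ?_)
    rw [sum_add_distrib, hdiag, sum_const, card_univ, Fintype.card_prod, ← hndef, smul_eq_mul]
    ring
  exact Nat.le_of_mul_le_mul_left hfin (by positivity)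

/-! ### Removing loops and parallel edges by switchings -/

lemma card_filter_exists_dart_le (hv : ∀ x, #{p | w p = x} = d)
    (x : V) : #{r | ∃ q, dart bar w q = (w r, x)} ≤ d * d := by
  have h : ({r | ∃ q, dart bar w q = (w r, x)} : Finset I)
      ⊆ ({q | w (bar q) = x} : Finset I).biUnion fun q => {r | w r = w q} := fun r hr => by
    obtain ⟨q, hq⟩ := (mem_filter.mp hr).2
    simp only [dart, Prod.mk.injEq] at hq
    simp only [mem_biUnion, mem_filter, mem_univ, true_and]
    exact ⟨q, hq.2, hq.1.symm⟩
  have h2 : #{q | w (bar q) = x} = d := by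
    rw [← hv x]
    exact card_equiv bar fun q => by simp
  refine (card_le_card h).trans ((card_biUnion_le_card_mul _ _ d fun q _ => (hv _).le).trans ?_)
  rw [h2]

lemma card_loops_le_defect (hne : ∀ p, bar p ≠ p) (hb : ∀ p, bar (bar p) = p) :
    #{r | w r = w (bar r)} ≤ defect bar w := by
  refine card_le_card_of_injOn (fun r => (r, bar r)) (fun r hr => ?_)
    (fun r _ r' _ h => (Prod.mk.inj h).1)
  simp only [coe_filter, mem_univ, true_and, Set.mem_ofPred_eq] at hr
  simp [dart, hb, hr, (hne r).symm]

/-- Exchanging the end of a bad edge with the end of a generic edge lowers the defect: a generic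
edge is not a loop, and it is so far away that the two new edges do not exist yet. -/
lemma exists_swap_defect_lt (hb : ∀ p, bar (bar p) = p) (hne : ∀ p, bar p ≠ p)
    (hw : ∀ x, #{p | w p = x} = d) (h0 : defect bar w ≠ 0)
    (hn : 2 * d ^ 2 + 2 * d + defect bar w < Fintype.card I) :
    ∃ p r, defect bar (w ∘ Equiv.swap p r) < defect bar w := by
  have hbarcard : ∀ P : I → Prop, ∀ [DecidablePred P], #{r | P (bar r)} = #{r | P r} :=
    fun P _ => card_equiv bar fun q => by simp
  obtain ⟨⟨p, q⟩, hpq⟩ := card_pos.mp (Nat.pos_of_ne_zero h0)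
  simp only [mem_filter, mem_univ, true_and] at hpq
  -- fewer than `n` half-edges `r` are excluded: those whose new edges would duplicate an old edge
  -- or be a loop, and those lying on a loop
  obtain ⟨r, hr⟩ : ∃ r, r ∉ (((({r | ∃ q, dart bar w q = (w r, w (bar p))} : Finset I) ∪
      ({r | ∃ q, dart bar w q = (w (bar r), w p)} : Finset I)) ∪
      (({r | w r = w (bar p)} : Finset I) ∪ ({r | w (bar r) = w p} : Finset I))) ∪
      ({r | w r = w (bar r)} : Finset I)) := by
    by_contra! hall
    have hle : Fintype.card I ≤ _ := (card_le_card fun r _ => hall r :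
      #(univ : Finset I) ≤ _)
    have h1 := card_filter_exists_dart_le (bar := bar) hw (w (bar p))
    have h2 := card_filter_exists_dart_le (bar := bar) hw (w p)
    rw [← hbarcard fun r => ∃ q, dart bar w q = (w r, w p)] at h2
    have h3 := hw (w (bar p))
    have h4 := hw (w p)
    rw [← hbarcard fun r => w r = w p] at h4
    have h5 := card_loops_le_defect (w := w) hne hb
    have := hle.trans ((card_union_le _ _).trans (add_le_add ((card_union_le _ _).trans
      (add_le_add (card_union_le _ _) (card_union_le _ _))) le_rfl))
    nlinarith
  simp only [mem_union, mem_filter, mem_univ, true_and, not_or, not_exists] at hr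
  obtain ⟨⟨⟨hr1, hr2⟩, hr3, hr4⟩, hr5⟩ := hr
  have hrp : r ≠ p := fun h => hr1 p (by rw [h]; rfl)
  have hrbp : r ≠ bar p := fun h => hr3 (by rw [h])
  have hbrp : bar r ≠ p := fun h => hrbp (by rw [← h, hb])
  have hbrbp : bar r ≠ bar p := bar.injective.ne hrp
  set w' := w ∘ Equiv.swap p r with hw'
  have ep : w' p = w r := by simp [hw']
  have er : w' r = w p := by simp [hw']
  have eo : ∀ x, x ≠ p → x ≠ r → w' x = w x := fun x h1 h2 => by
    simp [hw', Equiv.swap_apply_of_ne_of_ne h1 h2]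
  have ebp : w' (bar p) = w (bar p) := eo _ (hne p) (Ne.symm hrbp)
  have ebr : w' (bar r) = w (bar r) := eo _ hbrp (hne r)
  have dp : dart bar w' p = (w r, w (bar p)) := by simp [dart, ep, ebp]
  have dr : dart bar w' r = (w p, w (bar r)) := by simp [dart, er, ebr]
  have dbp : dart bar w' (bar p) = (w (bar p), w r) := by rw [dart_bar hb, dp]; rfl
  have dbr : dart bar w' (bar r) = (w (bar r), w p) := by rw [dart_bar hb, dr]; rfl
  have dor : ∀ x, x ≠ p → x ≠ r → x ≠ bar p → x ≠ bar r → dart bar w' x = dart bar w x :=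
    fun x h1 h2 h3 h4 => by
      simp only [dart]
      rw [eo x h1 h2, eo (bar x) (fun h => h3 (by rw [← h, hb])) (fun h => h4 (by rw [← h, hb]))]
  have hr1' : ∀ q, dart bar w q ≠ (w (bar p), w r) := fun q h => hr1 (bar q) (by
    rw [dart_bar hb, h]; rfl)
  have hr2' : ∀ q, dart bar w q ≠ (w p, w (bar r)) := fun q h => hr2 (bar q) (by
    rw [dart_bar hb, h]; rfl)
  have hrr : ¬(w r = w p ∧ w (bar p) = w (bar r)) := fun h => hr1 p (by
    simp [dart, h.1])
  -- the four half-edges of the new edges have pairwise distinct darts, not shared by old ones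
  have hnew : ∀ x y, x ≠ y → (x = p ∨ x = r ∨ x = bar p ∨ x = bar r) →
      dart bar w' x ≠ dart bar w' y := by
    intro x y hxy hx h
    by_cases hy : y = p ∨ y = r ∨ y = bar p ∨ y = bar r
    · rcases hx with rfl | rfl | rfl | rfl <;> rcases hy with rfl | rfl | rfl | rfl <;>
        first
        | exact hxy rfl
        | (simp only [dp, dr, dbp, dbr, Prod.mk.injEq] at h
           obtain ⟨h1, h2⟩ := h
           first
           | exact hr3 h1
           | exact hr3 h1.symm
           | exact hr4 h1
           | exact hr4 h1.symm
           | exact hrr ⟨h1, h2⟩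
           | exact hrr ⟨h1.symm, h2.symm⟩
           | exact hrr ⟨h2, h1⟩
           | exact hrr ⟨h2.symm, h1.symm⟩
           | exact hr5 h1
           | exact hr5 h1.symm
           | exact hr5 h2
           | exact hr5 h2.symm)
    · simp only [not_or] at hy
      rw [dor y hy.1 hy.2.1 hy.2.2.1 hy.2.2.2] at h
      rcases hx with rfl | rfl | rfl | rfl
      · exact hr1 y (by rw [← h, dp])
      · exact hr2' y (by rw [← h, dr])
      · exact hr1' y (by rw [← h, dbp])
      · exact hr2 y (by rw [← h, dbr])
  have hold : ∀ x y, x ≠ y → dart bar w' x = dart bar w' y →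
      x ≠ p ∧ dart bar w x = dart bar w y := fun x y hxy h => by
    by_cases hx : x = p ∨ x = r ∨ x = bar p ∨ x = bar r
    · exact absurd h (hnew x y hxy hx)
    by_cases hy : y = p ∨ y = r ∨ y = bar p ∨ y = bar r
    · exact absurd h.symm (hnew y x hxy.symm hy)
    simp only [not_or] at hx hy
    refine ⟨hx.1, ?_⟩
    rwa [dor x hx.1 hx.2.1 hx.2.2.1 hx.2.2.2, dor y hy.1 hy.2.1 hy.2.2.1 hy.2.2.2] at h
  refine ⟨p, r, card_lt_card ⟨fun x hx => ?_, fun hsub => ?_⟩⟩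
  · simp only [mem_filter, mem_univ, true_and] at hx ⊢
    exact ⟨hx.1, (hold _ _ hx.1 hx.2).2⟩
  · have := hsub (by simpa using hpq : (p, q) ∈ _)
    simp only [mem_filter, mem_univ, true_and] at this
    exact (hold _ _ this.1 this.2).1 rfl

lemma card_defect_le_succ_le (hb : ∀ p, bar (bar p) = p) (hne : ∀ p, bar p ≠ p)
    (hv : ∀ x, #{p | v p = x} = d) {k : ℕ}
    (hn : 2 * d ^ 2 + 2 * d + (k + 1) < Fintype.card I) :
    #{σ : Equiv.Perm I | defect bar (v ∘ σ) ≤ k + 1}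
      ≤ Fintype.card I ^ 2 * #{σ : Equiv.Perm I | defect bar (v ∘ σ) ≤ k} := by
  have hsub : ({σ : Equiv.Perm I | defect bar (v ∘ σ) ≤ k + 1} : Finset (Equiv.Perm I))
      ⊆ (univ : Finset (I × I)).biUnion fun x =>
        ({σ : Equiv.Perm I | defect bar (v ∘ σ) ≤ k} : Finset (Equiv.Perm I)).image
          fun σ => σ * Equiv.swap x.1 x.2 := fun σ hσ => by
    simp only [mem_filter, mem_univ, true_and] at hσ
    simp only [mem_biUnion, mem_image, mem_filter, mem_univ, true_and]
    obtain ⟨p, r, hpr⟩ : ∃ p r, defect bar ((v ∘ σ) ∘ Equiv.swap p r) ≤ k := by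
      by_cases h0 : defect bar (v ∘ σ) = 0
      · have : 0 < Fintype.card I := by omega
        obtain ⟨p⟩ := Fintype.card_pos_iff.mp this
        refine ⟨p, p, ?_⟩
        rw [Equiv.swap_self]
        simp [h0]
      · obtain ⟨p, r, h⟩ := exists_swap_defect_lt hb hne (card_fiber_comp hv σ) h0 (by omega)
        exact ⟨p, r, by omega⟩
    exact ⟨(p, r), σ * Equiv.swap p r, hpr, by simp [mul_assoc]⟩
  refine (card_le_card hsub).trans
    ((card_biUnion_le_card_mul _ _ _ fun x _ => card_image_le).trans ?_)
  rw [card_univ, Fintype.card_prod, sq]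

lemma card_defect_le_le (hb : ∀ p, bar (bar p) = p) (hne : ∀ p, bar p ≠ p)
    (hv : ∀ x, #{p | v p = x} = d) {k : ℕ} (hn : 2 * d ^ 2 + 2 * d + k < Fintype.card I) :
    #{σ : Equiv.Perm I | defect bar (v ∘ σ) ≤ k}
      ≤ Fintype.card I ^ (2 * k) * #{σ : Equiv.Perm I | defect bar (v ∘ σ) = 0} := by
  induction k with
  | zero => simp
  | succ k ih =>
    calc _ ≤ _ := card_defect_le_succ_le hb hne hv hn
      _ ≤ Fintype.card I ^ 2 * (Fintype.card I ^ (2 * k) *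
          #{σ : Equiv.Perm I | defect bar (v ∘ σ) = 0}) := by gcongr; exact ih (by omega)
      _ = _ := by ring

/-- Up to a polynomial factor, a random pairing is simple with positive probability. The defect is
at most twice its mean with probability at least one half, and finitely many switchings remove
it. -/
theorem card_perm_le_card_defect_eq_zero (hb : ∀ p, bar (bar p) = p) (hne : ∀ p, bar p ≠ p)
    (hv : ∀ x, #{p | v p = x} = d) (hn : 6 + 6 * d + 10 * d ^ 2 < Fintype.card I) :
    Fintype.card (Equiv.Perm I) ≤ 2 * Fintype.card I ^ (2 * (4 * d + 8 * d ^ 2)) *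
      #{σ : Equiv.Perm I | defect bar (v ∘ σ) = 0} := by
  have h1 := sum_defect_le hb hne hv (by omega)
  have h2 := card_defect_le_le hb hne hv (k := 4 * d + 8 * d ^ 2) (by omega)
  set K := 4 * d + 8 * d ^ 2 with hK
  have h3 : (K + 1) * #{σ : Equiv.Perm I | ¬ defect bar (v ∘ σ) ≤ K}
      ≤ ∑ σ : Equiv.Perm I, defect bar (v ∘ σ) := by
    rw [mul_comm, ← smul_eq_mul, ← sum_const]
    refine (sum_le_sum fun σ hσ => ?_).trans (sum_le_sum_of_subset (filter_subset
      (fun σ : Equiv.Perm I => ¬ defect bar (v ∘ σ) ≤ K) _))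
    have := (mem_filter.mp hσ).2
    omega
  have h4 : #{σ : Equiv.Perm I | defect bar (v ∘ σ) ≤ K}
      + #{σ : Equiv.Perm I | ¬ defect bar (v ∘ σ) ≤ K} = Fintype.card (Equiv.Perm I) := by
    rw [card_filter_add_card_filter_not, card_univ]
  have h5 : 2 * #{σ : Equiv.Perm I | ¬ defect bar (v ∘ σ) ≤ K} ≤ Fintype.card (Equiv.Perm I) := by
    by_contra h
    rw [not_le] at h
    have : (K + 1) * Fintype.card (Equiv.Perm I) <
        (K + 1) * (2 * #{σ : Equiv.Perm I | ¬ defect bar (v ∘ σ) ≤ K}) := by gcongr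
    nlinarith [Fintype.card_pos (α := Equiv.Perm I)]
  calc Fintype.card (Equiv.Perm I) ≤ 2 * #{σ : Equiv.Perm I | defect bar (v ∘ σ) ≤ K} := by omega
    _ ≤ 2 * (Fintype.card I ^ (2 * K) * #{σ : Equiv.Perm I | defect bar (v ∘ σ) = 0}) := by gcongr
    _ = _ := by ring

/-! ### The adjacency matrix under a switching -/

lemma sum_abs_pairMatrix_sub_le [Fintype V] (hb : ∀ p, bar (bar p) = p) (p r : I) :
    ∑ a, ∑ b, |pairMatrix bar (w ∘ Equiv.swap p r) a b - pairMatrix bar w a b| ≤ 8 := by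
  set w' := w ∘ Equiv.swap p r
  set T : Finset I := {p, r, bar p, bar r} with hT
  have hdart : ∀ x ∉ T, dart bar w' x = dart bar w x := fun x hx => by
    simp only [hT, mem_insert, mem_singleton, not_or] at hx
    simp only [dart, w', Function.comp]
    rw [Equiv.swap_apply_of_ne_of_ne hx.1 hx.2.1,
      Equiv.swap_apply_of_ne_of_ne (fun h => hx.2.2.1 (by rw [← h, hb]))
        (fun h => hx.2.2.2 (by rw [← h, hb]))]
  have h1 : ∀ a b, |pairMatrix bar w' a b - pairMatrix bar w a b|
      ≤ ∑ x ∈ T, ((if dart bar w' x = (a, b) then (1 : ℝ) else 0) +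
          (if dart bar w x = (a, b) then 1 else 0)) := fun a b => by
    simp only [pairMatrix, Matrix.of_apply]
    rw [← sum_sub_distrib, ← sum_subset (subset_univ T) fun x _ hx => by rw [hdart x hx, sub_self]]
    refine (abs_sum_le_sum_abs _ _).trans (sum_le_sum fun x _ => ?_)
    split_ifs <;> norm_num
  have h2 : ∀ y : V × V, ∑ a, ∑ b, (if y = (a, b) then (1 : ℝ) else 0) = 1 := fun y => by
    rw [← Fintype.sum_prod_type' (f := fun a b => if y = (a, b) then (1 : ℝ) else 0)]
    simp
  have h3 : (#T : ℝ) ≤ 4 := by exact_mod_cast card_le_four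
  calc _ ≤ ∑ a, ∑ b, ∑ x ∈ T, ((if dart bar w' x = (a, b) then (1 : ℝ) else 0) +
          (if dart bar w x = (a, b) then 1 else 0)) :=
        sum_le_sum fun a _ => sum_le_sum fun b _ => h1 a b
    _ = ∑ x ∈ T, ∑ a, ∑ b, ((if dart bar w' x = (a, b) then (1 : ℝ) else 0) +
          (if dart bar w x = (a, b) then 1 else 0)) := by
        rw [sum_congr rfl fun a _ => sum_comm, sum_comm]
    _ = ∑ x ∈ T, (2 : ℝ) := sum_congr rfl fun x _ => by
        simp only [sum_add_distrib, h2]; norm_num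
    _ ≤ 8 := by rw [sum_const, nsmul_eq_mul]; linarith

end Pairing

/-! ### Regular graphs as simple pairings -/

section Representation

open Finset

variable {I V : Type*}

/-- The pairing `bar` with the labelling `w` has no loops or parallel edges, and its edges are those
of `𝒢`. -/
def Represents (bar : Equiv.Perm I) (w : I → V) (𝒢 : SimpleGraph V) : Prop :=
  Function.Injective (dart bar w) ∧ ∀ a b, 𝒢.Adj a b ↔ ∃ p, dart bar w p = (a, b)

variable {bar : Equiv.Perm I} {v w : I → V} {d : ℕ} {𝒢 : SimpleGraph V}

lemma represents_pairGraph (hb : ∀ p, bar (bar p) = p) (hne : ∀ p, bar p ≠ p)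
    (h : Function.Injective (dart bar w)) : Represents bar w (pairGraph bar hb w) := by
  refine ⟨h, fun a b => ⟨fun h' => h'.2, fun ⟨p, hp⟩ => ⟨fun hab => ?_, p, hp⟩⟩⟩
  subst hab
  exact hne p (h (by rw [dart_bar hb, hp]; rfl))

lemma Represents.pairGraph_eq (hb : ∀ p, bar (bar p) = p) (h : Represents bar w 𝒢) :
    pairGraph bar hb w = 𝒢 := by
  ext a b
  rw [h.2]
  exact ⟨fun h' => h'.2, fun h' => ⟨((h.2 a b).mpr h').ne, h'⟩⟩

lemma Represents.comp_perm {σ : Equiv.Perm I} (hσ : ∀ p, σ (bar p) = bar (σ p))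
    (h : Represents bar w 𝒢) : Represents bar (w ∘ σ) 𝒢 := by
  have hd : ∀ p, dart bar (w ∘ σ) p = dart bar w (σ p) := fun p => by simp [dart, hσ]
  refine ⟨fun p q hpq => σ.injective (h.1 ?_), fun a b => ?_⟩
  · rwa [hd, hd] at hpq
  · rw [h.2]
    exact ⟨fun ⟨p, hp⟩ => ⟨σ.symm p, by rw [hd]; simpa using hp⟩,
      fun ⟨p, hp⟩ => ⟨σ p, by rw [← hd, hp]⟩⟩

/-- Two simple pairings with the same graph differ by a relabelling of the half-edges that
commutes with the pairing. -/
lemma Represents.exists_perm [Finite I] {w' : I → V} (hb : ∀ p, bar (bar p) = p)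
    (h : Represents bar w 𝒢) (h' : Represents bar w' 𝒢) :
    ∃ σ : Equiv.Perm I, (∀ p, σ (bar p) = bar (σ p)) ∧ w' = w ∘ σ := by
  have hex : ∀ p, ∃ q, dart bar w q = dart bar w' p := fun p =>
    (h.2 _ _).mp ((h'.2 (w' p) (w' (bar p))).mpr ⟨p, rfl⟩)
  choose f hf using hex
  have hinj : Function.Injective f := fun p q hpq => h'.1 (by rw [← hf, ← hf, hpq])
  refine ⟨Equiv.ofBijective f (Finite.injective_iff_bijective.mp hinj), fun p => h.1 ?_, ?_⟩
  · simp only [Equiv.ofBijective_apply]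
    rw [hf, dart_bar hb, dart_bar hb, hf]
  · funext p
    exact (congrArg Prod.fst (hf p)).symm

variable [Fintype I]

lemma Represents.card_adj [Fintype V] [DecidableEq V] [DecidableRel 𝒢.Adj]
    (hw : ∀ x, #{p | w p = x} = d) (h : Represents bar w 𝒢) (a : V) :
    #{b | 𝒢.Adj a b} = d := by
  rw [← hw a]
  refine (card_bij (fun p _ => w (bar p)) (fun p hp => ?_) (fun p hp q hq hpq => ?_)
    (fun b hb => ?_)).symm
  · simp only [mem_filter, mem_univ, true_and] at hp ⊢
    exact (h.2 _ _).mpr ⟨p, by rw [← hp]; rfl⟩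
  · simp only [mem_filter, mem_univ, true_and] at hp hq
    exact h.1 (Prod.ext (by simp [dart, hp, hq]) hpq)
  · simp only [mem_filter, mem_univ, true_and] at hb
    obtain ⟨p, hp⟩ := (h.2 _ _).mp hb
    simp only [dart, Prod.mk.injEq] at hp
    exact ⟨p, by simp [hp.1], hp.2⟩

lemma Represents.pairMatrix_eq [DecidableEq V] [DecidableRel 𝒢.Adj]
    (h : Represents bar w 𝒢) : pairMatrix bar w = 𝒢.adjMatrix ℝ := by
  classical
  ext a b
  rw [SimpleGraph.adjMatrix_apply, pairMatrix, Matrix.of_apply]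
  split_ifs with hab
  · obtain ⟨p, hp⟩ := (h.2 a b).mp hab
    rw [sum_eq_single p, if_pos hp]
    · exact fun q _ hq => if_neg fun hq' => hq (h.1 (hq'.trans hp.symm))
    · simp
  · exact sum_eq_zero fun p _ => if_neg fun hp => hab ((h.2 a b).mpr ⟨p, hp⟩)

variable [DecidableEq I]

lemma cycleType_of_involutive {σ : Equiv.Perm I} (hb : ∀ p, σ (σ p) = p) (hne : ∀ p, σ p ≠ p) :
    σ.cycleType = Multiset.replicate (Fintype.card I / 2) 2 := by
  have h1 : σ ^ 2 = 1 := by ext p; simp [sq, hb]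
  have h2 := Equiv.Perm.pow_prime_eq_one_iff.mp h1
  have h3 := Multiset.eq_replicate_card.mpr h2
  have h4 := σ.sum_cycleType
  have h5 : σ.support = univ := by ext p; simp [hne]
  rw [h5, card_univ, h3, Multiset.sum_replicate, smul_eq_mul] at h4
  rw [h3, ← h4]; simp

/-- Every regular graph is represented: its darts and the half-edges carry fixed-point free
involutions, and any two of those on sets of the same size are conjugate. -/
lemma exists_represents [Fintype V] [DecidableEq V] [DecidableRel 𝒢.Adj]
    (hb : ∀ p, bar (bar p) = p) (hne : ∀ p, bar p ≠ p) (hv : ∀ x, #{p | v p = x} = d)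
    (h𝒢 : ∀ a, #{b | 𝒢.Adj a b} = d) : ∃ σ : Equiv.Perm I, Represents bar (v ∘ σ) 𝒢 := by
  have hdeg : ∀ a, 𝒢.degree a = d := fun a => by
    rw [← h𝒢 a, ← SimpleGraph.card_neighborFinset_eq_degree, SimpleGraph.neighborFinset_eq_filter]
  have hcard : Fintype.card I = Fintype.card 𝒢.Dart := by
    rw [𝒢.dart_card_eq_sum_degrees, ← card_univ,
      card_eq_sum_card_fiberwise (f := v) (t := univ) (by simp)]
    simp [hv, hdeg]
  let e := Fintype.equivOfCardEq hcard
  let β : Equiv.Perm I := e.symm.permCongr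
    (Function.Involutive.toPerm SimpleGraph.Dart.symm SimpleGraph.Dart.symm_involutive)
  have hβ : ∀ p, e (β p) = (e p).symm := fun p => by simp [β, Equiv.permCongr_apply]
  have hβb : ∀ p, β (β p) = p := fun p => e.injective (by simp [hβ])
  have hβne : ∀ p, β p ≠ p := fun p h => (e p).symm_ne (by rw [← hβ, h])
  obtain ⟨c, hc⟩ := isConj_iff.mp (Equiv.Perm.isConj_iff_cycleType_eq.mpr
    ((cycleType_of_involutive hb hne).trans (cycleType_of_involutive hβb hβne).symm))
  have hcb : ∀ p, c (bar p) = β (c p) := fun p => by rw [← hc]; simp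
  set w : I → V := fun p => (e (c p)).fst with hwdef
  have hdart : ∀ p, dart bar w p = (e (c p)).toProd := fun p => by
    simp only [dart, hwdef, hcb, hβ]; rfl
  have hw : ∀ x, #{p | w p = x} = d := fun x => by
    rw [← hdeg x, ← 𝒢.dart_fst_fiber_card_eq_degree x]
    exact card_equiv (c.trans e) fun p => by simp [hwdef]
  have hrep : Represents bar w 𝒢 := by
    refine ⟨fun p q hpq => c.injective (e.injective ?_), fun a b => ⟨fun hab => ?_, ?_⟩⟩
    · rw [hdart, hdart] at hpq
      exact SimpleGraph.Dart.toProd_injective hpq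
    · exact ⟨c.symm (e.symm ⟨(a, b), hab⟩), by rw [hdart]; simp⟩
    · rintro ⟨p, hp⟩
      rw [hdart] at hp
      have := (e (c p)).adj
      rwa [hp] at this
  let σ : Equiv.Perm I := Equiv.ofFiberEquiv (f := w) (g := v) fun x =>
    Fintype.equivOfCardEq (by rw [Fintype.card_subtype, Fintype.card_subtype, hw, hv])
  have hσ : v ∘ σ = w := funext fun p => Equiv.ofFiberEquiv_map _ p
  exact ⟨σ, by rwa [hσ]⟩

open Classical in
/-- All graphs are represented by the same number of permutations, if by any: two permutations
represent the same graph exactly when they differ by a vertex preserving permutation on the left and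
a permutation commuting with the pairing on the right. -/
lemma card_represents [DecidableEq V] (hb : ∀ p, bar (bar p) = p) {σ₁ : Equiv.Perm I}
    (h : Represents bar (v ∘ σ₁) 𝒢) :
    #{σ : Equiv.Perm I | Represents bar (v ∘ σ) 𝒢}
      = #{ρ : Equiv.Perm I | v ∘ ρ = v} *
        #{κ : Equiv.Perm I | ∀ p, κ (bar p) = bar (κ p)} := by
  rw [← card_product]
  refine (card_bij (fun x _ => x.1 * σ₁ * x.2) (fun x hx => ?_) (fun x hx y hy hxy => ?_)
    (fun σ hσ => ?_)).symm
  · simp only [mem_product, mem_filter, mem_univ, true_and] at hx ⊢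
    have := h.comp_perm hx.2
    rwa [show v ∘ (x.1 * σ₁ * x.2 : Equiv.Perm I) = (v ∘ σ₁) ∘ x.2 by
      funext p; simpa using congrFun hx.1 (σ₁ (x.2 p))]
  · simp only [mem_product, mem_filter, mem_univ, true_and] at hx hy
    have h2 : x.2 = y.2 := by
      have hw : ∀ p, v (σ₁ (x.2 p)) = v (σ₁ (y.2 p)) := fun p => by
        have h3 := congrFun hx.1 (σ₁ (x.2 p))
        have h4 := congrFun hy.1 (σ₁ (y.2 p))
        have h5 := congrArg v (Equiv.congr_fun hxy p)
        simp only [Function.comp, Equiv.Perm.mul_apply] at h3 h4 h5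
        rw [← h3, ← h4, h5]
      ext p
      refine h.1 (Prod.ext (hw p) ?_)
      have := hw (bar p)
      rwa [hx.2, hy.2] at this
    have h1 : x.1 = y.1 := by
      rw [h2] at hxy
      exact mul_right_cancel (mul_right_cancel hxy)
    exact Prod.ext h1 h2
  · simp only [mem_filter, mem_univ, true_and] at hσ
    obtain ⟨κ, hκ, hw⟩ := h.exists_perm hb hσ
    refine ⟨(σ * κ⁻¹ * σ₁⁻¹, κ), ?_, by simp [mul_assoc]⟩
    simp only [mem_product, mem_filter, mem_univ, true_and]
    refine ⟨funext fun p => ?_, hκ⟩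
    have := congrFun hw (κ⁻¹ (σ₁⁻¹ p))
    simpa using this

open Classical in
lemma card_mul_card_regular [Fintype V] [DecidableEq V] (hb : ∀ p, bar (bar p) = p)
    (hne : ∀ p, bar p ≠ p) (hv : ∀ x, #{p | v p = x} = d) (P : SimpleGraph V → Prop) :
    #{ρ : Equiv.Perm I | v ∘ ρ = v} * #{κ : Equiv.Perm I | ∀ p, κ (bar p) = bar (κ p)} *
        #{𝒢 : SimpleGraph V | (∀ a, #{b | 𝒢.Adj a b} = d) ∧ P 𝒢}
      = #{σ : Equiv.Perm I | defect bar (v ∘ σ) = 0 ∧ P (pairGraph bar hb (v ∘ σ))} := by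
  refine Eq.symm ((card_eq_sum_card_fiberwise
    (f := fun σ : Equiv.Perm I => pairGraph bar hb (v ∘ σ))
    (t := {𝒢 : SimpleGraph V | (∀ a, #{b | 𝒢.Adj a b} = d) ∧ P 𝒢}) (fun σ hσ => ?_)).trans ?_)
  rotate_left
  · rw [mul_comm, ← smul_eq_mul, ← sum_const]
    refine sum_congr rfl fun 𝒢 h𝒢 => ?_
    simp only [mem_filter, mem_univ, true_and] at h𝒢
    obtain ⟨σ₁, h₁⟩ := exists_represents hb hne hv h𝒢.1
    rw [← card_represents hb h₁, filter_filter]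
    congr 1
    ext σ
    simp only [mem_filter, mem_univ, true_and]
    constructor
    · rintro ⟨⟨h, -⟩, rfl⟩
      exact represents_pairGraph hb hne (defect_eq_zero_iff.mp h)
    · intro h
      have := h.pairGraph_eq hb
      exact ⟨⟨defect_eq_zero_iff.mpr h.1, by rw [this]; exact h𝒢.2⟩, this⟩
  · simp only [coe_filter, mem_univ, true_and, Set.mem_ofPred_eq] at hσ ⊢
    exact ⟨(represents_pairGraph hb hne (defect_eq_zero_iff.mp hσ.1)).card_adj
      (card_fiber_comp hv σ), hσ.2⟩

open Classical in
/-- Comparison of the uniform regular graph with the random pairing: an event is at most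
polynomially more likely for the former. -/
theorem card_regular_mul_card_perm_le [Fintype V] [DecidableEq V] (hb : ∀ p, bar (bar p) = p)
    (hne : ∀ p, bar p ≠ p) (hv : ∀ x, #{p | v p = x} = d)
    (hn : 6 + 6 * d + 10 * d ^ 2 < Fintype.card I) (P : SimpleGraph V → Prop) :
    #{𝒢 : SimpleGraph V | (∀ a, #{b | 𝒢.Adj a b} = d) ∧ P 𝒢} * Fintype.card (Equiv.Perm I)
      ≤ 2 * Fintype.card I ^ (2 * (4 * d + 8 * d ^ 2)) *
        #{𝒢 : SimpleGraph V | ∀ a, #{b | 𝒢.Adj a b} = d} *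
        #{σ : Equiv.Perm I | defect bar (v ∘ σ) = 0 ∧ P (pairGraph bar hb (v ∘ σ))} := by
  have h1 := card_perm_le_card_defect_eq_zero hb hne hv hn
  have h2 := card_mul_card_regular hb hne hv P
  have h3 := card_mul_card_regular hb hne hv fun _ => True
  simp only [and_true] at h3
  set k := #{ρ : Equiv.Perm I | v ∘ ρ = v} * #{κ : Equiv.Perm I | ∀ p, κ (bar p) = bar (κ p)}
  rw [← h3] at h1
  rw [← h2]
  calc _ ≤ #{𝒢 : SimpleGraph V | (∀ a, #{b | 𝒢.Adj a b} = d) ∧ P 𝒢} *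
        (2 * Fintype.card I ^ (2 * (4 * d + 8 * d ^ 2)) *
          (k * #{𝒢 : SimpleGraph V | ∀ a, #{b | 𝒢.Adj a b} = d})) := by gcongr
    _ = _ := by ring

open Classical in
lemma exists_regular [Fintype V] [DecidableEq V] (hb : ∀ p, bar (bar p) = p)
    (hne : ∀ p, bar p ≠ p) (hv : ∀ x, #{p | v p = x} = d)
    (hn : 6 + 6 * d + 10 * d ^ 2 < Fintype.card I) :
    ∃ 𝒢 : SimpleGraph V, ∀ a, #{b | 𝒢.Adj a b} = d := by
  have h1 := card_perm_le_card_defect_eq_zero hb hne hv hn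
  have h2 : 0 < #{σ : Equiv.Perm I | defect bar (v ∘ σ) = 0} := by
    by_contra! h
    have h3 := Fintype.card_pos (α := Equiv.Perm I)
    simp only [nonpos_iff_eq_zero.mp h, mul_zero] at h1
    omega
  obtain ⟨σ, hσ⟩ := card_pos.mp h2
  exact ⟨_, (represents_pairGraph hb hne (defect_eq_zero_iff.mp (mem_filter.mp hσ).2)).card_adj
    (card_fiber_comp hv σ)⟩

end Representation

/-! ### Linear statistics of the resolvent diagonal -/

section Statistic

open Matrix

variable {N : ℕ} {φ : ℝ → ℝ} {z : ℂ} {B L l t : ℝ} {A A' W W' : Matrix (Fin N) (Fin N) ℝ}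

/-- The average of `φ (Im G_jj)` over `j`, for the resolvent `G` of `W` at `z`. -/
noncomputable def stat (φ : ℝ → ℝ) (z : ℂ) (W : Matrix (Fin N) (Fin N) ℝ) : ℝ :=
  (1 / (N : ℝ)) * ∑ j, φ (green z W j j).im

/-- The matrix `-t A + diag g`. -/
noncomputable def ham (t : ℝ) (A : Matrix (Fin N) (Fin N) ℝ) (g : Fin N → ℝ) :
    Matrix (Fin N) (Fin N) ℝ := (-t) • A + Matrix.diagonal g

lemma ham_isSymm (hA : A.IsSymm) (g : Fin N → ℝ) : (ham t A g).IsSymm :=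
  (hA.smul _).add (Matrix.isSymm_diagonal g)

/-- What is needed of a test function `φ` at the spectral parameter `z`: bounds `0 ≤ φ ≤ B` and a
Lipschitz constant `L` on an interval `[0, l]` that contains `Im G_jj`. -/
structure Admissible (φ : ℝ → ℝ) (z : ℂ) (l B L : ℝ) : Prop where
  measurable : Measurable φ
  im_pos : 0 < z.im
  one_div_im_le : 1 / z.im ≤ l
  nonneg : ∀ x, 0 ≤ x → x ≤ l → 0 ≤ φ x
  le : ∀ x, 0 ≤ x → x ≤ l → φ x ≤ B
  lipschitz : ∀ x y, x ≤ l → y ≤ l → |φ x - φ y| ≤ L * |x - y|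
  lipschitz_pos : 0 < L

namespace Admissible

variable (h : Admissible φ z l B L)
include h

lemma l_pos : 0 < l := (one_div_pos.mpr h.im_pos).trans_le h.one_div_im_le

lemma stat_nonneg (hW : W.IsSymm) : 0 ≤ stat φ z W :=
  mul_nonneg (by positivity) (Finset.sum_nonneg fun j _ =>
    h.nonneg _ (im_green_nonneg hW h.im_pos j) ((im_green_le hW h.im_pos j).trans h.one_div_im_le))

lemma stat_le (hN : 0 < N) (hW : W.IsSymm) : stat φ z W ≤ B := by
  have hN' : (0 : ℝ) < N := by exact_mod_cast hN
  rw [stat, one_div, inv_mul_le_iff₀ hN']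
  refine (Finset.sum_le_sum fun j _ =>
    h.le _ (im_green_nonneg hW h.im_pos j)
      ((im_green_le hW h.im_pos j).trans h.one_div_im_le)).trans ?_
  simp

lemma abs_stat_le (hN : 0 < N) (hW : W.IsSymm) : |stat φ z W| ≤ B := by
  rw [abs_of_nonneg (h.stat_nonneg hW)]; exact h.stat_le hN hW

lemma abs_stat_sub_le (hW : W.IsSymm) (hW' : W'.IsSymm) :
    |stat φ z W' - stat φ z W| ≤ L / N * ∑ j, ‖green z W' j j - green z W j j‖ := by
  rw [stat, stat, ← mul_sub, ← Finset.sum_sub_distrib, abs_mul, abs_of_nonneg (by positivity),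
    div_eq_mul_one_div L, mul_comm L, mul_assoc, Finset.mul_sum]
  refine mul_le_mul_of_nonneg_left ?_ (by positivity)
  refine (Finset.abs_sum_le_sum_abs _ _).trans (Finset.sum_le_sum fun j _ => ?_)
  refine (h.lipschitz _ _ ((im_green_le hW' h.im_pos j).trans h.one_div_im_le)
    ((im_green_le hW h.im_pos j).trans h.one_div_im_le)).trans ?_
  refine mul_le_mul_of_nonneg_left ?_ h.lipschitz_pos.le
  rw [← Complex.sub_im]
  exact Complex.abs_im_le_norm _

lemma abs_stat_ham_update_sub_le (hA : A.IsSymm) (g : Fin N → ℝ) (i : Fin N) (y : ℝ) :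
    |stat φ z (ham t A (Function.update g i y)) - stat φ z (ham t A g)| ≤ L * l / N := by
  have hs : ham t A (Function.update g i y) = ham t A g + Matrix.single i i (y - g i) := by
    rw [ham, ham, add_assoc]
    congr 1
    ext a b
    by_cases hab : a = b
    · subst hab
      by_cases hai : a = i
      · subst hai; simp
      · simp [hai, Matrix.single, Ne.symm hai]
    · by_cases hia : i = a
      · subst hia; simp [Matrix.single, hab]
      · simp [Matrix.single, hab, hia]
  refine (h.abs_stat_sub_le (ham_isSymm hA g) (ham_isSymm hA _)).trans ?_
  have h1 := (sum_norm_green_add_single_sub_le (ham_isSymm (t := t) hA g) h.im_pos i _ hs).trans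
    h.one_div_im_le
  rw [mul_div_right_comm]
  exact mul_le_mul_of_nonneg_left h1 (div_nonneg h.lipschitz_pos.le (by positivity))

lemma abs_stat_ham_sub_le (ht : 0 < t) (hA : A.IsSymm) (hA' : A'.IsSymm) (g : Fin N → ℝ) :
    |stat φ z (ham t A' g) - stat φ z (ham t A g)|
      ≤ L * l ^ 2 * t / N * ∑ a, ∑ b, |A' a b - A a b| := by
  refine (h.abs_stat_sub_le (ham_isSymm hA g) (ham_isSymm hA' _)).trans ?_
  have h1 := sum_norm_green_sub_le (ham_isSymm (t := t) hA g) (ham_isSymm (t := t) hA' g) h.im_pos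
  have h2 : ∑ a, ∑ b, |ham t A g a b - ham t A' g a b| = t * ∑ a, ∑ b, |A' a b - A a b| := by
    simp only [Finset.mul_sum]
    refine Finset.sum_congr rfl fun a _ => Finset.sum_congr rfl fun b _ => ?_
    rw [← abs_of_pos ht, ← abs_mul, abs_of_pos ht]
    congr 1
    simp only [ham, Matrix.add_apply, Matrix.smul_apply, smul_eq_mul]
    ring
  rw [h2] at h1
  have h3 : 1 / z.im ^ 2 ≤ l ^ 2 := by
    have h4 := h.one_div_im_le
    have h5 := one_div_pos.mpr h.im_pos
    rw [← _root_.one_div_pow]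
    gcongr
  calc _ ≤ L / N * (t * ∑ a, ∑ b, |A' a b - A a b| / z.im ^ 2) := by
        have := h.lipschitz_pos
        gcongr
        simpa [Finset.mul_sum, Finset.sum_div, mul_div_assoc] using h1
    _ = L / N * (t * ∑ a, ∑ b, |A' a b - A a b|) * (1 / z.im ^ 2) := by
        simp only [div_eq_mul_inv, ← Finset.sum_mul]; ring
    _ ≤ L / N * (t * ∑ a, ∑ b, |A' a b - A a b|) * l ^ 2 := by
        refine mul_le_mul_of_nonneg_left h3 ?_
        have := h.lipschitz_pos
        positivity
    _ = _ := by ring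

lemma measurable_stat_ham {Ω : Type*} [MeasurableSpace Ω] {W : Ω → Matrix (Fin N) (Fin N) ℝ}
    (hW : ∀ i j, Measurable fun ω => W ω i j) : Measurable fun ω => stat φ z (W ω) := by
  unfold stat
  refine (Finset.measurable_fun_sum _ fun j _ => ?_).const_mul _
  exact h.measurable.comp (Complex.measurable_im.comp (measurable_green hW j j))

end Admissible

lemma measurable_ham_apply (A : Matrix (Fin N) (Fin N) ℝ) (i j : Fin N) :
    Measurable fun g : Fin N → ℝ => ham t A g i j := by
  by_cases hij : i = j
  · subst hij; simp only [ham, Matrix.add_apply, Matrix.diagonal_apply_eq]; fun_prop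
  · simp only [ham, Matrix.add_apply, Matrix.diagonal_apply_ne _ hij]; fun_prop

/-- The law of the potential. -/
noncomputable abbrev gaussianPi (N : ℕ) : Measure (Fin N → ℝ) :=
  Measure.pi fun _ : Fin N => gaussianReal 0 1

/-- The average of the linear statistic over the potential. -/
noncomputable def quenched (φ : ℝ → ℝ) (z : ℂ) (t : ℝ) (A : Matrix (Fin N) (Fin N) ℝ) : ℝ :=
  ∫ g, stat φ z (ham t A g) ∂(gaussianPi N)

namespace Admissible

variable (h : Admissible φ z l B L)
include h

lemma integrable_stat_ham (hN : 0 < N) (hA : A.IsSymm) :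
    Integrable (fun g => stat φ z (ham t A g)) (gaussianPi N) :=
  integrable_of_measurable_of_abs_le (h.measurable_stat_ham (measurable_ham_apply A))
    fun g => h.abs_stat_le hN (ham_isSymm hA g)

lemma measureReal_stat_sub_quenched_le (hN : 0 < N) (hA : A.IsSymm) {r : ℝ} (hr : 0 ≤ r) :
    (gaussianPi N).real {g | r ≤ |stat φ z (ham t A g) - quenched φ z t A|}
      ≤ 2 * Real.exp (-(r ^ 2 / (2 * (N * (L * l / N) ^ 2)))) :=
  measureReal_abs_sub_integral_ge_le _ (fun g => stat φ z (ham t A g)) hr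
    (by have := h.lipschitz_pos; have := h.l_pos; positivity)
    (h.measurable_stat_ham (measurable_ham_apply A))
    (fun g => h.abs_stat_le hN (ham_isSymm hA g))
    (fun g i y => h.abs_stat_ham_update_sub_le hA g i y)

lemma quenched_mem_Icc (hN : 0 < N) (hA : A.IsSymm) : quenched φ z t A ∈ Set.Icc 0 B := by
  refine ⟨integral_nonneg fun g => h.stat_nonneg (ham_isSymm hA g), ?_⟩
  refine (integral_mono (h.integrable_stat_ham hN hA) (integrable_const B)
    fun g => h.stat_le hN (ham_isSymm hA g)).trans ?_
  simp

lemma abs_quenched_sub_le (hN : 0 < N) (ht : 0 < t) (hA : A.IsSymm) (hA' : A'.IsSymm) :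
    |quenched φ z t A' - quenched φ z t A|
      ≤ L * l ^ 2 * t / N * ∑ a, ∑ b, |A' a b - A a b| := by
  rw [quenched, quenched,
    ← integral_sub (h.integrable_stat_ham hN hA') (h.integrable_stat_ham hN hA)]
  have := norm_integral_le_of_norm_le_const (μ := gaussianPi N)
    (f := fun g => stat φ z (ham t A' g) - stat φ z (ham t A g))
    (.of_forall fun g => h.abs_stat_ham_sub_le ht hA hA' g)
  simpa using this

end Admissible

end Statistic

/-! ### Concentration for the uniform regular graph -/

section RegularGraph

open Finset

variable {N d : ℕ}

instance : MeasurableSingletonClass (SimpleGraph (Fin N)) where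
  measurableSet_singleton 𝒢 := by
    have h : ({𝒢} : Set (SimpleGraph (Fin N))) = SimpleGraph.Adj ⁻¹' {𝒢.Adj} := by
      ext 𝒢'
      exact SimpleGraph.ext_iff
    rw [h]
    exact SimpleGraph.measurable_adj (measurableSet_singleton _)

open Classical in
lemma mem_regularGraphs_iff {𝒢 : SimpleGraph (Fin N)} :
    𝒢 ∈ regularGraphs d N ↔ ∀ a, #{b | 𝒢.Adj a b} = d := by
  simp only [regularGraphs, Set.mem_ofPred_eq, SimpleGraph.IsRegularOfDegree]
  refine forall_congr' fun a => ?_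
  rw [← SimpleGraph.card_neighborFinset_eq_degree, SimpleGraph.neighborFinset_eq_filter]

open Classical in
lemma uniformOn_regularGraphs_real (P : SimpleGraph (Fin N) → Prop) :
    (uniformOn (regularGraphs d N)).real {𝒢 | P 𝒢}
      = #{𝒢 : SimpleGraph (Fin N) | (∀ a, #{b | 𝒢.Adj a b} = d) ∧ P 𝒢}
        / #{𝒢 : SimpleGraph (Fin N) | ∀ a, #{b | 𝒢.Adj a b} = d} := by
  have h1 : regularGraphs d N
      = (({𝒢 : SimpleGraph (Fin N) | ∀ a, #{b | 𝒢.Adj a b} = d} : Finset _) :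
        Set (SimpleGraph (Fin N))) := by
    ext 𝒢; simp [mem_regularGraphs_iff]
  have h2 : {𝒢 : SimpleGraph (Fin N) | P 𝒢}
      = (({𝒢 : SimpleGraph (Fin N) | P 𝒢} : Finset _) : Set (SimpleGraph (Fin N))) := by
    ext 𝒢; simp
  rw [measureReal_def, h1, h2, uniformOn_apply_finset, ← filter_and]
  simp

/-- A set of half-edges with `d` of them at each of `N` vertices, and a pairing of them. -/
lemma exists_pairing (hNd : Even (N * d)) :
    ∃ (bar : Equiv.Perm (Fin (N * d / 2) × Bool)) (v : Fin (N * d / 2) × Bool → Fin N),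
      (∀ p, bar (bar p) = p) ∧ (∀ p, bar p ≠ p) ∧ ∀ x, #{p | v p = x} = d := by
  have hcard : Fintype.card (Fin (N * d / 2) × Bool) = Fintype.card (Fin N × Fin d) := by
    simp [Nat.div_mul_cancel hNd.two_dvd]
  let e := Fintype.equivOfCardEq hcard
  refine ⟨Equiv.prodCongr (Equiv.refl _) (Function.Involutive.toPerm _ Bool.involutive_not),
    fun p => (e p).1, fun p => ?_, fun p => ?_, fun x => ?_⟩
  · ext <;> simp
  · simp [Prod.ext_iff]
  · have h1 : #{p | (e p).1 = x} = #{q : Fin N × Fin d | q.1 = x} :=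
      card_equiv e fun p => by simp
    have h2 : ({q : Fin N × Fin d | q.1 = x} : Finset _) = {x} ×ˢ (univ : Finset (Fin d)) := by
      ext q; simp [Prod.ext_iff, eq_comm]
    rw [h1, h2]
    simp

/-- Bound for the probability that the quenched average of a uniform regular graph deviates
from its typical value: the bound for a random pairing, divided by a lower bound for the
probability that the pairing is simple. -/
noncomputable def graphError (N d : ℕ) (c r : ℝ) : ℝ :=
  4 * ((N * d : ℕ) : ℝ) ^ (2 * (4 * d + 8 * d ^ 2)) *
    Real.exp (-(r ^ 2 / (8 * (N * d : ℕ) * c ^ 2)))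

open Classical in
theorem Admissible.exists_uniformOn_quenched_le_of_pairing {I : Type*} [Fintype I] [DecidableEq I]
    {bar : Equiv.Perm I} {v : I → Fin N} (hb : ∀ p, bar (bar p) = p) (hne : ∀ p, bar p ≠ p)
    (hv : ∀ x, #{p | v p = x} = d) (hcard : Fintype.card I = N * d)
    {φ : ℝ → ℝ} {z : ℂ} {B L l t r : ℝ}
    (h : Admissible φ z l B L) (ht : 0 < t) (hr : 0 ≤ r)
    (hn : 6 + 6 * d + 10 * d ^ 2 < N * d) :
    ∃ m ∈ Set.Icc 0 B, (uniformOn (regularGraphs d N)).real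
      {𝒢 | r ≤ |quenched φ z t (𝒢.adjMatrix ℝ) - m|}
        ≤ graphError N d (L * l ^ 2 * t / N * 8) r := by
  have hN : 0 < N := by
    rcases Nat.eq_zero_or_pos N with rfl | h
    · simp at hn
    · exact h
  have hI : 0 < Fintype.card I := by omega
  have : Nonempty I := Fintype.card_pos_iff.mp hI
  set f : Equiv.Perm I → ℝ := fun σ => quenched φ z t (pairMatrix bar (v ∘ σ)) with hf
  set c := L * l ^ 2 * t / N * 8 with hc
  have hc0 : 0 < c := by
    have := h.lipschitz_pos; have := h.l_pos; positivity
  have hlip : ∀ σ a b, |f (σ * Equiv.swap a b) - f σ| ≤ c := fun σ a b => by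
    refine (h.abs_quenched_sub_le hN ht (pairMatrix_isSymm hb) (pairMatrix_isSymm hb)).trans ?_
    refine mul_le_mul_of_nonneg_left (sum_abs_pairMatrix_sub_le (w := v ∘ σ) hb a b) ?_
    have := h.lipschitz_pos; have := h.l_pos; positivity
  have hconc := card_perm_abs_sub_avg_ge_le f hc0 hr hlip
  have hmem : ∀ σ, f σ ∈ Set.Icc 0 B := fun σ => h.quenched_mem_Icc hN (pairMatrix_isSymm hb)
  have hT : (0 : ℝ) < Fintype.card (Equiv.Perm I) := by exact_mod_cast Fintype.card_pos
  refine ⟨avg f, ⟨div_nonneg (sum_nonneg fun σ _ => (hmem σ).1) hT.le, ?_⟩, ?_⟩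
  · rw [avg, div_le_iff₀ hT]
    refine (sum_le_sum fun σ _ => (hmem σ).2).trans ?_
    simp [mul_comm]
  · rw [uniformOn_regularGraphs_real]
    obtain ⟨𝒢₀, h𝒢₀⟩ := exists_regular (bar := bar) hb hne hv (by rw [hcard]; exact hn)
    have hR : (0 : ℝ) < #{𝒢 : SimpleGraph (Fin N) | ∀ a, #{b | 𝒢.Adj a b} = d} := by
      exact_mod_cast card_pos.mpr ⟨𝒢₀, by simpa using h𝒢₀⟩
    have hcmp := card_regular_mul_card_perm_le (bar := bar) hb hne hv (by rw [hcard]; exact hn)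
      fun 𝒢 => r ≤ |quenched φ z t (𝒢.adjMatrix ℝ) - avg f|
    have hsub : #{σ : Equiv.Perm I | defect bar (v ∘ σ) = 0 ∧
        r ≤ |quenched φ z t ((pairGraph bar hb (v ∘ σ)).adjMatrix ℝ) - avg f|}
        ≤ Nat.card {σ // r ≤ |f σ - avg f|} := by
      rw [Nat.card_eq_fintype_card, Fintype.card_subtype]
      refine card_le_card (monotone_filter_right _ fun σ _ hσ => ?_)
      have := (represents_pairGraph hb hne (defect_eq_zero_iff.mp hσ.1)).pairMatrix_eq
      simp only [hf, this]
      exact hσ.2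
    have hsub' := (Nat.cast_le (α := ℝ)).mpr hsub
    have hcmp' := (Nat.cast_le (α := ℝ)).mpr hcmp
    push_cast at hcmp'
    rw [hcard] at hconc hcmp'
    rw [div_le_iff₀ hR, ← mul_le_mul_iff_left₀ hT]
    refine (le_of_eq (by congr!)).trans (hcmp'.trans ?_)
    rw [graphError]
    calc _ ≤ 2 * ((N * d : ℕ) : ℝ) ^ (2 * (4 * d + 8 * d ^ 2)) *
          #{𝒢 : SimpleGraph (Fin N) | ∀ a, #{b | 𝒢.Adj a b} = d} *
          (2 * Fintype.card (Equiv.Perm I) * Real.exp (-(r ^ 2 / (8 * (N * d : ℕ) * c ^ 2)))) := by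
          gcongr
          exact hsub'.trans hconc
      _ = _ := by ring

open Classical in
theorem Admissible.exists_uniformOn_quenched_le {φ : ℝ → ℝ} {z : ℂ} {B L l t r : ℝ}
    (h : Admissible φ z l B L) (ht : 0 < t) (hr : 0 ≤ r) (hNd : Even (N * d))
    (hn : 6 + 6 * d + 10 * d ^ 2 < N * d) :
    ∃ m ∈ Set.Icc 0 B, (uniformOn (regularGraphs d N)).real
      {𝒢 | r ≤ |quenched φ z t (𝒢.adjMatrix ℝ) - m|}
        ≤ graphError N d (L * l ^ 2 * t / N * 8) r := by
  obtain ⟨bar, v, hb, hne, hv⟩ := exists_pairing hNd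
  exact h.exists_uniformOn_quenched_le_of_pairing hb hne hv
    (by simp [Nat.div_mul_cancel hNd.two_dvd]) ht hr hn

lemma regularGraphs_nonempty (hNd : Even (N * d)) (hn : 6 + 6 * d + 10 * d ^ 2 < N * d) :
    (regularGraphs d N).Nonempty := by
  obtain ⟨bar, v, hb, hne, hv⟩ := exists_pairing hNd
  obtain ⟨𝒢, h𝒢⟩ := exists_regular hb hne hv (by simpa [Nat.div_mul_cancel hNd.two_dvd] using hn)
  exact ⟨𝒢, mem_regularGraphs_iff.mpr h𝒢⟩

end RegularGraph

/-! ### The law of the graph and the potential -/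

section Law

variable {N d : ℕ} {s t : ℝ} {z : ℂ}

open Classical in
lemma hamiltonian_eq_ham (ω : SimpleGraph (Fin N) × (Fin N → ℝ)) :
    hamiltonian t ω = ham t (ω.1.adjMatrix ℝ) ω.2 := rfl

lemma imDiagPow_eq (j : Fin N) (ω : SimpleGraph (Fin N) × (Fin N → ℝ)) :
    imDiagPow t s z j ω = (green z (hamiltonian t ω) j j).im ^ s := rfl

lemma hamiltonian_isSymm (ω : SimpleGraph (Fin N) × (Fin N → ℝ)) : (hamiltonian t ω).IsSymm := by
  classical
  rw [hamiltonian_eq_ham]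
  exact ham_isSymm (SimpleGraph.isSymm_adjMatrix _) _

lemma measurable_hamiltonian_apply (i j : Fin N) :
    Measurable fun ω : SimpleGraph (Fin N) × (Fin N → ℝ) => hamiltonian t ω i j :=
  measurable_from_prod_countable_right fun 𝒢 => by
    classical
    exact measurable_ham_apply (𝒢.adjMatrix ℝ) i j

lemma measurable_imDiagPow (j : Fin N) : Measurable (imDiagPow (N := N) t s z j) := by
  have h : Measurable fun ω : SimpleGraph (Fin N) × (Fin N → ℝ) =>
      (green z (hamiltonian t ω) j j).im :=
    Complex.measurable_im.comp (measurable_green measurable_hamiltonian_apply j j)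
  exact h.pow_const s

instance (S : Set (SimpleGraph (Fin N))) : IsZeroOrProbabilityMeasure (uniformOn S) := by
  unfold uniformOn; infer_instance

instance : IsFiniteMeasure (law d N) := by
  unfold law; infer_instance

lemma abs_imDiagPow_le (hs : 0 < s) (hz : 0 < z.im) (j : Fin N)
    (ω : SimpleGraph (Fin N) × (Fin N → ℝ)) : |imDiagPow t s z j ω| ≤ (1 / z.im) ^ s := by
  have h0 := im_green_nonneg (hamiltonian_isSymm (t := t) ω) hz j
  rw [imDiagPow_eq, abs_of_nonneg (Real.rpow_nonneg h0 s)]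
  exact Real.rpow_le_rpow h0 (im_green_le (hamiltonian_isSymm ω) hz j) hs.le

lemma integrable_imDiagPow (hs : 0 < s) (hz : 0 < z.im) (j : Fin N) :
    Integrable (imDiagPow t s z j) (law d N) :=
  integrable_of_measurable_of_abs_le (measurable_imDiagPow j) (abs_imDiagPow_le hs hz j)

/-! ### Exchangeability of the vertices -/

/-- A permutation of the vertices acting on graphs and potentials. -/
def relabel (π : Equiv.Perm (Fin N)) (ω : SimpleGraph (Fin N) × (Fin N → ℝ)) :
    SimpleGraph (Fin N) × (Fin N → ℝ) :=
  (ω.1.comap π, ω.2 ∘ π)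

lemma hamiltonian_relabel (π : Equiv.Perm (Fin N)) (ω : SimpleGraph (Fin N) × (Fin N → ℝ)) :
    hamiltonian t (relabel π ω) = (hamiltonian t ω).submatrix π π := by
  ext a b
  simp only [hamiltonian, relabel, Matrix.add_apply, Matrix.smul_apply, Matrix.submatrix_apply,
    Matrix.diagonal_apply, SimpleGraph.adjMatrix_apply, Function.comp,
    π.injective.eq_iff]
  congr 2

lemma imDiagPow_relabel (π : Equiv.Perm (Fin N)) (j : Fin N)
    (ω : SimpleGraph (Fin N) × (Fin N → ℝ)) :
    imDiagPow t s z j (relabel π ω) = imDiagPow t s z (π j) ω := by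
  rw [imDiagPow_eq, imDiagPow_eq, hamiltonian_relabel, green_reindex]

lemma comap_mem_regularGraphs_iff (π : Equiv.Perm (Fin N)) (𝒢 : SimpleGraph (Fin N)) :
    𝒢.comap π ∈ regularGraphs d N ↔ 𝒢 ∈ regularGraphs d N := by
  classical
  rw [mem_regularGraphs_iff, mem_regularGraphs_iff]
  refine Iff.trans (forall_congr' fun a => ?_)
    (π.forall_congr_right (q := fun a => Finset.card {b | 𝒢.Adj a b} = d))
  exact iff_of_eq (congrArg (· = d) (Finset.card_equiv π fun b => by simp))

lemma measurePreserving_comap (π : Equiv.Perm (Fin N)) :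
    MeasurePreserving (fun 𝒢 : SimpleGraph (Fin N) => 𝒢.comap π)
      (uniformOn (regularGraphs d N)) (uniformOn (regularGraphs d N)) := by
  have hm : Measurable fun 𝒢 : SimpleGraph (Fin N) => 𝒢.comap π := measurable_of_countable _
  have hinj : Function.Injective fun 𝒢 : SimpleGraph (Fin N) => 𝒢.comap π := fun 𝒢 𝒢' h => by
    ext a b
    have := congrArg (fun H : SimpleGraph (Fin N) => H.Adj (π.symm a) (π.symm b)) h
    simpa using this
  have hbij := Finite.injective_iff_bijective.mp hinj
  refine ⟨hm, Measure.ext fun S hS => ?_⟩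
  rw [Measure.map_apply hm hS, uniformOn, cond_apply (Set.toFinite _).measurableSet,
    cond_apply (Set.toFinite _).measurableSet]
  have h : regularGraphs d N ∩ S = (fun 𝒢 : SimpleGraph (Fin N) => 𝒢.comap π) ''
      (regularGraphs d N ∩ (fun 𝒢 : SimpleGraph (Fin N) => 𝒢.comap π) ⁻¹' S) := by
    ext 𝒢
    constructor
    · rintro ⟨h1, h2⟩
      obtain ⟨𝒢', rfl⟩ := hbij.2 𝒢
      exact ⟨𝒢', ⟨(comap_mem_regularGraphs_iff π 𝒢').mp h1, h2⟩, rfl⟩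
    · rintro ⟨𝒢', ⟨h1, h2⟩, rfl⟩
      exact ⟨(comap_mem_regularGraphs_iff π 𝒢').mpr h1, h2⟩
  rw [h, Measure.count_injective_image hinj]

lemma measurePreserving_relabel (π : Equiv.Perm (Fin N)) :
    MeasurePreserving (relabel π) (law d N) (law d N) := by
  have h2 : MeasurePreserving (fun g : Fin N → ℝ => g ∘ π) (gaussianPi N) (gaussianPi N) := by
    have h := measurePreserving_piCongrLeft (α := fun _ : Fin N => ℝ)
      (fun _ : Fin N => gaussianReal 0 1) π.symm
    convert h using 1
    funext g i
    have := Equiv.piCongrLeft_apply_apply (fun _ : Fin N => ℝ) π.symm g (π i)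
    simp only [Equiv.symm_apply_apply] at this
    exact this.symm
  exact (measurePreserving_comap π).prod h2

lemma integral_imDiagPow_eq (i j : Fin N) :
    ∫ ω, imDiagPow t s z i ω ∂(law d N) = ∫ ω, imDiagPow t s z j ω ∂(law d N) := by
  have h := measurePreserving_relabel (d := d) (Equiv.swap i j)
  conv_lhs => rw [← h.map_eq]
  rw [integral_map h.measurable.aemeasurable (measurable_imDiagPow i).aestronglyMeasurable]
  simp only [imDiagPow_relabel, Equiv.swap_apply_left]

lemma integral_average_imDiagPow (hs : 0 < s) (hz : 0 < z.im) (i : Fin N) :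
    ∫ ω, (1 / (N : ℝ)) * ∑ j, imDiagPow t s z j ω ∂(law d N)
      = ∫ ω, imDiagPow t s z i ω ∂(law d N) := by
  have hN : (N : ℝ) ≠ 0 := by
    have := i.pos
    positivity
  rw [integral_const_mul, integral_finsetSum _ fun j _ => integrable_imDiagPow hs hz j,
    Finset.sum_congr rfl fun j _ => integral_imDiagPow_eq j i]
  simp [hN]

/-! ### Concentration under the joint law -/

lemma abs_integral_sub_le {Ω : Type*} [MeasurableSpace Ω] {μ : Measure Ω} [IsProbabilityMeasure μ]
    {X : Ω → ℝ} {B m a δ : ℝ} (hX : Measurable X) (hXB : ∀ ω, X ω ∈ Set.Icc 0 B)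
    (hm : m ∈ Set.Icc 0 B) (ha : 0 ≤ a) (h : μ.real {ω | a ≤ |X ω - m|} ≤ δ) :
    |∫ ω, X ω ∂μ - m| ≤ a + B * δ := by
  have hB : 0 ≤ B := hm.1.trans hm.2
  set S := {ω | a ≤ |X ω - m|}
  have hS : MeasurableSet S := measurableSet_le measurable_const (by fun_prop)
  have hXi : Integrable X μ := integrable_of_measurable_of_abs_le hX fun ω => by
    rw [abs_of_nonneg (hXB ω).1]; exact (hXB ω).2
  have hind : Integrable (S.indicator fun _ => B) μ := (integrable_const B).indicator hS
  have hpt : ∀ ω, |X ω - m| ≤ a + S.indicator (fun _ => B) ω := fun ω => by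
    by_cases hω : ω ∈ S
    · rw [Set.indicator_of_mem hω]
      have : |X ω - m| ≤ B := by
        rw [abs_le]; constructor <;> linarith [(hXB ω).1, (hXB ω).2, hm.1, hm.2]
      linarith
    · rw [Set.indicator_of_notMem hω, add_zero]
      exact (not_le.mp hω).le
  have h1 : ∫ ω, X ω ∂μ - m = ∫ ω, (X ω - m) ∂μ := by
    rw [integral_sub hXi (integrable_const m)]; simp
  rw [h1]
  calc |∫ ω, (X ω - m) ∂μ| ≤ ∫ ω, |X ω - m| ∂μ := abs_integral_le_integral_abs
    _ ≤ ∫ ω, (a + S.indicator (fun _ => B) ω) ∂μ :=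
        integral_mono (hXi.sub (integrable_const m)).abs ((integrable_const a).add hind) hpt
    _ = a + μ.real S * B := by
        rw [integral_add (integrable_const a) hind, integral_indicator_const B hS]; simp
    _ ≤ a + B * δ := by rw [mul_comm]; gcongr

/-- Bound for the probability that the linear statistic deviates from its typical value by `2 r`:
half of the deviation is left to the potential and half to the graph. -/
noncomputable def deviationError (N d : ℕ) (t L l r : ℝ) : ℝ :=
  2 * Real.exp (-(r ^ 2 / (2 * (N * (L * l / N) ^ 2)))) + graphError N d (L * l ^ 2 * t / N * 8) r

theorem Admissible.exists_law_stat_le {φ : ℝ → ℝ} {B L l r : ℝ}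
    (h : Admissible φ z l B L) (ht : 0 < t) (hr : 0 ≤ r) (hNd : Even (N * d))
    (hn : 6 + 6 * d + 10 * d ^ 2 < N * d) :
    ∃ m ∈ Set.Icc 0 B, (law d N).real {ω | 2 * r ≤ |stat φ z (hamiltonian t ω) - m|}
      ≤ deviationError N d t L l r := by
  classical
  have hN : 0 < N := by
    rcases Nat.eq_zero_or_pos N with rfl | h
    · simp at hn
    · exact h
  obtain ⟨m, hm, hq⟩ := h.exists_uniformOn_quenched_le ht hr hNd hn
  have : IsProbabilityMeasure (uniformOn (regularGraphs d N)) :=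
    isProbabilityMeasure_uniformOn (Set.toFinite _) (regularGraphs_nonempty hNd hn)
  refine ⟨m, hm, ?_⟩
  set q : SimpleGraph (Fin N) → ℝ := fun 𝒢 => quenched φ z t (𝒢.adjMatrix ℝ)
  set S₁ : Set (SimpleGraph (Fin N) × (Fin N → ℝ)) :=
    {ω | r ≤ |stat φ z (hamiltonian t ω) - q ω.1|}
  set S₂ : Set (SimpleGraph (Fin N)) := {𝒢 | r ≤ |q 𝒢 - m|}
  have hq_meas : Measurable q := measurable_of_countable _
  have hsm : Measurable fun ω : SimpleGraph (Fin N) × (Fin N → ℝ) => stat φ z (hamiltonian t ω) :=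
    h.measurable_stat_ham measurable_hamiltonian_apply
  have hS₁ : MeasurableSet S₁ :=
    measurableSet_le measurable_const ((hsm.sub (hq_meas.comp measurable_fst)).abs)
  have hsub : {ω | 2 * r ≤ |stat φ z (hamiltonian t ω) - m|} ⊆ S₁ ∪ S₂ ×ˢ Set.univ := fun ω hω => by
    by_contra hcon
    simp only [Set.mem_union, Set.mem_prod, Set.mem_univ, and_true, not_or] at hcon
    have h1 : |stat φ z (hamiltonian t ω) - q ω.1| < r := not_le.mp hcon.1
    have h2 : |q ω.1 - m| < r := not_le.mp hcon.2
    have h3 : 2 * r ≤ |stat φ z (hamiltonian t ω) - m| := hω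
    linarith [abs_sub_le (stat φ z (hamiltonian t ω)) (q ω.1) m]
  have hb₁ : (law d N).real S₁ ≤ 2 * Real.exp (-(r ^ 2 / (2 * (N * (L * l / N) ^ 2)))) := by
    rw [measureReal_def]
    refine ENNReal.toReal_le_of_le_ofReal (by positivity) ?_
    rw [law, Measure.prod_apply hS₁]
    refine (lintegral_mono fun 𝒢 => ?_).trans (le_of_eq (?_ :
      ∫⁻ _, ENNReal.ofReal (2 * Real.exp (-(r ^ 2 / (2 * (N * (L * l / N) ^ 2)))))
        ∂(uniformOn (regularGraphs d N)) = _))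
    · rw [ENNReal.le_ofReal_iff_toReal_le (measure_ne_top _ _) (by positivity)]
      exact h.measureReal_stat_sub_quenched_le hN (SimpleGraph.isSymm_adjMatrix 𝒢) hr
    · simp
  have hb₂ : (law d N).real (S₂ ×ˢ Set.univ) ≤ graphError N d (L * l ^ 2 * t / N * 8) r := by
    rw [law, measureReal_prod_prod]
    simpa using hq
  refine (measureReal_mono hsub).trans ((measureReal_union_le _ _).trans ?_)
  exact add_le_add hb₁ hb₂

lemma admissible_truncPow {ε l : ℝ} (hs : 0 < s) (hz : 0 < z.im) (hzl : 1 / z.im ≤ l) (hε : 0 < ε)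
    (hεl : ε ≤ l) : Admissible (truncPow s ε) z l (l ^ s) (s * l ^ s / ε) where
  measurable := measurable_truncPow
  im_pos := hz
  one_div_im_le := hzl
  nonneg _ _ _ := truncPow_nonneg hε
  le _ _ hx := truncPow_le hs hε hεl hx
  lipschitz _ _ hx hy := abs_truncPow_sub_truncPow_le hs hε hεl hx hy
  lipschitz_pos := by have := hε.trans_le hεl; positivity

lemma abs_average_sub_stat_le {ε : ℝ} (hs : 0 < s) (hz : 0 < z.im) (hε : 0 < ε) (hN : 0 < N)
    (ω : SimpleGraph (Fin N) × (Fin N → ℝ)) :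
    |(1 / (N : ℝ)) * ∑ j, imDiagPow t s z j ω - stat (truncPow s ε) z (hamiltonian t ω)|
      ≤ ε ^ s := by
  have hN' : (0 : ℝ) < N := by exact_mod_cast hN
  rw [stat, ← mul_sub, ← Finset.sum_sub_distrib, abs_mul, abs_of_nonneg (by positivity), one_div,
    inv_mul_le_iff₀ hN']
  refine (Finset.abs_sum_le_sum_abs _ _).trans ((Finset.sum_le_sum fun j _ => ?_).trans
    (le_of_eq ?_) (b := ∑ _j : Fin N, ε ^ s))
  · rw [abs_sub_comm, imDiagPow_eq]
    exact abs_truncPow_sub_le hs hε.le (im_green_nonneg (hamiltonian_isSymm ω) hz j)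
  · simp

/-- The concentration estimate with explicit error terms, at the scale `1 / l` with `1 / η ≤ l`. -/
theorem one_sub_le_law_real {l ε : ℝ} (hs : 0 < s) (ht : 0 < t) (hz : 0 < z.im)
    (hzl : 1 / z.im ≤ l) (hε : 0 < ε) (hεl : ε ≤ l) (hεs : ε ^ s ≤ 1 / (4 * l))
    (hNd : Even (N * d)) (hn : 6 + 6 * d + 10 * d ^ 2 < N * d)
    (herr : l ^ s * deviationError N d t (s * l ^ s / ε) l (1 / (16 * l)) ≤ 1 / (8 * l))
    (i : Fin N) :
    1 - deviationError N d t (s * l ^ s / ε) l (1 / (16 * l)) ≤ (law d N).real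
      {ω | |(1 / (N : ℝ)) * ∑ j, imDiagPow t s z j ω - ∫ ω', imDiagPow t s z i ω' ∂(law d N)|
        ≤ z.im} := by
  have hN : 0 < N := i.pos
  have : IsProbabilityMeasure (uniformOn (regularGraphs d N)) :=
    isProbabilityMeasure_uniformOn (Set.toFinite _) (regularGraphs_nonempty hNd hn)
  have : IsProbabilityMeasure (law d N) := by unfold law; infer_instance
  have hA := admissible_truncPow hs hz hzl hε hεl
  have hl := hA.l_pos
  obtain ⟨m, hm, hdev⟩ := hA.exists_law_stat_le (r := 1 / (16 * l)) ht (by positivity) hNd hn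
  set δ := deviationError N d t (s * l ^ s / ε) l (1 / (16 * l))
  set X : SimpleGraph (Fin N) × (Fin N → ℝ) → ℝ :=
    fun ω => stat (truncPow s ε) z (hamiltonian t ω)
  set Y : SimpleGraph (Fin N) × (Fin N → ℝ) → ℝ :=
    fun ω => (1 / (N : ℝ)) * ∑ j, imDiagPow t s z j ω
  have hXm : Measurable X := hA.measurable_stat_ham measurable_hamiltonian_apply
  have hXB : ∀ ω, X ω ∈ Set.Icc 0 (l ^ s) := fun ω =>
    ⟨hA.stat_nonneg (hamiltonian_isSymm ω), hA.stat_le hN (hamiltonian_isSymm ω)⟩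
  have hXY : ∀ ω, |Y ω - X ω| ≤ 1 / (4 * l) := fun ω =>
    (abs_average_sub_stat_le hs hz hε hN ω).trans hεs
  have hXi : Integrable X (law d N) := integrable_of_measurable_of_abs_le hXm fun ω => by
    rw [abs_of_nonneg (hXB ω).1]; exact (hXB ω).2
  have hYi : Integrable Y (law d N) :=
    (integrable_finsetSum _ fun j _ => integrable_imDiagPow hs hz j).const_mul _
  have hmean : |∫ ω, X ω ∂(law d N) - m| ≤ 2 * (1 / (16 * l)) + l ^ s * δ :=
    abs_integral_sub_le hXm hXB hm (by positivity) hdev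
  have hmean' : |∫ ω, Y ω ∂(law d N) - ∫ ω, X ω ∂(law d N)| ≤ 1 / (4 * l) := by
    rw [← integral_sub hYi hXi]
    have := norm_integral_le_of_norm_le_const (μ := law d N) (f := fun ω => Y ω - X ω)
      (.of_forall hXY)
    simpa using this
  rw [← integral_average_imDiagPow hs hz i]
  have hgood : {ω | 2 * (1 / (16 * l)) ≤ |X ω - m|}ᶜ
      ⊆ {ω | |Y ω - ∫ ω', Y ω' ∂(law d N)| ≤ z.im} := fun ω hω => by
    have h1 : |X ω - m| < 2 * (1 / (16 * l)) := not_le.mp hω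
    have h2 := hXY ω
    have hzl' : 1 / l ≤ z.im := by
      rw [div_le_iff₀ hz] at hzl
      rw [div_le_iff₀ hl]; linarith
    -- the errors add up to `1 / 4 + 1 / 8 + (1 / 8 + 1 / 8) + 1 / 4 = 7 / 8` of `1 / l ≤ η`
    have e1 : 1 / (4 * l) = 1 / 4 * (1 / l) := by ring
    have e2 : 1 / (16 * l) = 1 / 16 * (1 / l) := by ring
    have e3 : 1 / (8 * l) = 1 / 8 * (1 / l) := by ring
    have h3 : 0 < 1 / l := by positivity
    rw [e1] at h2 hmean'
    rw [e2] at h1 hmean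
    rw [e3] at herr
    simp only [abs_le, abs_lt] at h1 h2 hmean hmean'
    change |Y ω - ∫ ω', Y ω' ∂(law d N)| ≤ z.im
    rw [abs_le]
    constructor <;> linarith [h1.1, h1.2, h2.1, h2.2, hmean.1, hmean.2, hmean'.1, hmean'.2]
  have hS : MeasurableSet {ω | 2 * (1 / (16 * l)) ≤ |X ω - m|} :=
    measurableSet_le measurable_const (by fun_prop)
  refine le_trans ?_ (measureReal_mono hgood)
  rw [probReal_compl_eq_one_sub hS]
  linarith

end Law

/-! ### Asymptotics of the error terms -/

section Asymptotics

open Filter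

lemma eventually_mul_log_rpow_le (C a : ℝ) :
    ∀ᶠ N : ℕ in atTop, C * Real.log N ^ a ≤ (N : ℝ) := by
  have h := (isLittleO_log_rpow_rpow_atTop a one_pos).comp_tendsto
    (tendsto_natCast_atTop_atTop (R := ℝ))
  filter_upwards [h.bound (c := (|C| + 1)⁻¹) (by positivity), eventually_ge_atTop 1] with N hN h1
  have hlog : 0 ≤ Real.log N := Real.log_natCast_nonneg N
  simp only [Function.comp, Real.rpow_one, Real.norm_eq_abs, Nat.abs_cast] at hN
  rw [abs_of_nonneg (Real.rpow_nonneg hlog a), inv_mul_eq_div, le_div_iff₀ (by positivity)] at hN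
  have : C ≤ |C| := le_abs_self C
  nlinarith [Real.rpow_nonneg hlog a]

lemma exp_neg_le_inv_pow {N k : ℕ} (hN : 0 < N) {x : ℝ} (hx : k * Real.log N ≤ x) :
    Real.exp (-x) ≤ ((N : ℝ) ^ k)⁻¹ := by
  have hN' : (0 : ℝ) < N := by exact_mod_cast hN
  rw [Real.exp_neg]
  refine inv_anti₀ (by positivity) ?_
  rw [← Real.exp_log (pow_pos hN' k), Real.log_pow]
  exact Real.exp_le_exp.mpr hx

/-- The truncation level with `ε ^ s = 1 / (4 log N)`. -/
noncomputable def truncLevel (s : ℝ) (N : ℕ) : ℝ := ((4 * Real.log N) ^ (1 / s))⁻¹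

theorem eventually_deviationError_le (s t : ℝ) (hs : 0 < s) (ht : 0 < t) (d : ℕ) (hd : 0 < d) :
    ∀ᶠ N : ℕ in atTop, deviationError N d t (s * Real.log N ^ s / truncLevel s N) (Real.log N)
      (1 / (16 * Real.log N)) ≤ (N : ℝ) ^ (-100 : ℤ) := by
  set Q := 2 * (4 * d + 8 * d ^ 2) with hQ
  set c₀ := s * 4 ^ (1 / s) with hc₀
  have hc₀pos : 0 < c₀ := by positivity
  have hd' : (0 : ℝ) < d := by exact_mod_cast hd
  filter_upwards [eventually_ge_atTop 4,
    eventually_mul_log_rpow_le (101 * 512 * c₀ ^ 2) (2 * (s + 1 / s) + 5),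
    eventually_mul_log_rpow_le ((102 + Q : ℕ) * (131072 * d * t ^ 2) * c₀ ^ 2)
      (2 * (s + 1 / s) + 7),
    eventually_ge_atTop (8 * d ^ Q)] with N hN4 h1 h2 h3
  have hN : (0 : ℝ) < N := by positivity
  have hlog : 0 < Real.log N := Real.log_pos (by exact_mod_cast (by omega : 1 < N))
  set l := Real.log N with hl
  set L := s * l ^ s / truncLevel s N with hL
  have hLeq : L = c₀ * l ^ (s + 1 / s) := by
    rw [hL, truncLevel, div_inv_eq_mul, Real.mul_rpow (by norm_num) hlog.le, Real.rpow_add hlog,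
      hc₀]
    ring
  have hLpos : 0 < L := by rw [hLeq]; positivity
  have hLpow : ∀ k : ℕ, c₀ ^ 2 * l ^ (2 * (s + 1 / s) + k) = L ^ 2 * l ^ k := fun k => by
    rw [hLeq, Real.rpow_add hlog, Real.rpow_natCast, mul_comm 2, Real.rpow_mul hlog.le]
    norm_num [mul_pow]
    ring
  have hL5 := hLpow 5
  have hL7 := hLpow 7
  push_cast at hL5 hL7
  rw [mul_assoc, hL5] at h1
  rw [mul_assoc, hL7] at h2
  -- one power of `N` beyond the target absorbs the factor `2`, two powers absorb `4 d ^ Q`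
  have e1 : Real.exp (-((1 / (16 * l)) ^ 2 / (2 * (N * (L * l / N) ^ 2))))
      ≤ ((N : ℝ) ^ 101)⁻¹ := by
    refine exp_neg_le_inv_pow (by omega) ?_
    have : (1 / (16 * l)) ^ 2 / (2 * (N * (L * l / N) ^ 2)) = N / (512 * L ^ 2 * l ^ 4) := by
      field_simp; norm_num
    rw [this, le_div_iff₀ (by positivity)]
    calc _ = 101 * 512 * (L ^ 2 * l ^ 5) := by push_cast; rw [← hl]; ring
      _ ≤ _ := h1
  have e2 : Real.exp (-((1 / (16 * l)) ^ 2 / (8 * (N * d : ℕ) * (L * l ^ 2 * t / N * 8) ^ 2)))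
      ≤ ((N : ℝ) ^ (102 + Q))⁻¹ := by
    refine exp_neg_le_inv_pow (by omega) ?_
    have : (1 / (16 * l)) ^ 2 / (8 * (N * d : ℕ) * (L * l ^ 2 * t / N * 8) ^ 2)
        = N / (131072 * d * t ^ 2 * L ^ 2 * l ^ 6) := by
      push_cast; field_simp; norm_num
    rw [this, le_div_iff₀ (by positivity)]
    calc _ = (102 + Q : ℕ) * (131072 * d * t ^ 2) * (L ^ 2 * l ^ 7) := by rw [← hl]; ring
      _ ≤ _ := h2
  have h3' : 8 * (d : ℝ) ^ Q ≤ N := by exact_mod_cast h3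
  have h4 : (4 : ℝ) ≤ N := by exact_mod_cast hN4
  have hz : (N : ℝ) ^ (-100 : ℤ) = ((N : ℝ) ^ 100)⁻¹ := by
    rw [zpow_neg]; norm_cast
  rw [hz, deviationError, graphError, ← hQ]
  calc _ ≤ 2 * ((N : ℝ) ^ 101)⁻¹ + 4 * ((N * d : ℕ) : ℝ) ^ Q * ((N : ℝ) ^ (102 + Q))⁻¹ := by
        gcongr
    _ = ((N : ℝ) ^ 100)⁻¹ * (2 / N + 4 * d ^ Q / N ^ 2) := by
        push_cast; rw [mul_pow, pow_add]; field_simp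
    _ ≤ ((N : ℝ) ^ 100)⁻¹ * 1 := by
        refine mul_le_mul_of_nonneg_left ?_ (by positivity)
        have a1 : 2 / (N : ℝ) ≤ 1 / 2 := by rw [div_le_div_iff₀ hN two_pos]; linarith
        have a2 : 4 * (d : ℝ) ^ Q / N ^ 2 ≤ 1 / 2 := by
          rw [div_le_div_iff₀ (by positivity) two_pos]; nlinarith
        linarith
    _ = _ := mul_one _

end Asymptotics

end TightBinding

open Filter in
theorem lemma3p2 (s t : ℝ) (hs : 0 < s) (ht : 0 < t) (d : ℕ) (hd : 3 ≤ d) :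
    ∃ C : ℝ, 1 < C ∧
      ∀ (N : ℕ) (hN : d + 1 ≤ N), Even (N * d) →
        ∀ E η : ℝ, (Real.log (N : ℝ))⁻¹ ≤ η →
          -- the expectation in the next conjunct is that of an integrable random variable
          Integrable (TightBinding.imDiagPow t s (⟨E, η⟩ : ℂ) (⟨0, by omega⟩ : Fin N))
            (TightBinding.law d N) ∧
          1 - C * (N : ℝ) ^ (-100 : ℤ) ≤
            (TightBinding.law d N).real
              {ω | |(1 / (N : ℝ)) * ∑ j : Fin N, TightBinding.imDiagPow t s (⟨E, η⟩ : ℂ) j ω -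
                  ∫ ω', TightBinding.imDiagPow t s (⟨E, η⟩ : ℂ) (⟨0, by omega⟩ : Fin N) ω'
                    ∂(TightBinding.law d N)| ≤ η} := by
  open TightBinding in
  obtain ⟨N₀, hN₀⟩ := eventually_atTop.mp ((eventually_deviationError_le s t hs ht d (by omega)).and
    ((eventually_mul_log_rpow_le 8 (s + 1)).and (eventually_ge_atTop (7 + 6 * d + 10 * d ^ 2))))
  refine ⟨(N₀ : ℝ) ^ 100 + 2, by have : (0 : ℝ) ≤ (N₀ : ℝ) ^ 100 := by positivity
                                 linarith, fun N hN hNd E η hη => ?_⟩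
  have hN0 : (0 : ℝ) < N := by exact_mod_cast (by omega : 0 < N)
  have hN1 : (4 : ℝ) ≤ N := by exact_mod_cast (by omega : 4 ≤ N)
  have hlog : 1 ≤ Real.log N := by
    rw [Real.le_log_iff_exp_le hN0]
    linarith [Real.exp_one_lt_d9]
  set l := Real.log N
  have hl0 : 0 < l := by linarith
  have hη0 : 0 < η := (inv_pos.mpr hl0).trans_le hη
  set z : ℂ := ⟨E, η⟩
  have hz : 0 < z.im := hη0
  refine ⟨integrable_imDiagPow hs hz _, ?_⟩
  have hpow : (N : ℝ) ^ (-100 : ℤ) = ((N : ℝ) ^ 100)⁻¹ := by rw [zpow_neg]; norm_cast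
  rcases lt_or_ge N N₀ with hlt | hge
  · -- for the finitely many remaining `N` the lower bound is not positive
    refine le_trans ?_ measureReal_nonneg
    have h1 : (N : ℝ) ^ 100 ≤ (N₀ : ℝ) ^ 100 := by gcongr
    have h2 : 1 ≤ ((N₀ : ℝ) ^ 100 + 2) * ((N : ℝ) ^ 100)⁻¹ := by
      rw [← div_eq_mul_inv, le_div_iff₀ (by positivity)]; linarith
    rw [hpow]
    linarith
  · obtain ⟨hdev, hlogN, hbig⟩ := hN₀ N hge
    have h4l : 1 ≤ (4 * l) ^ (1 / s) := Real.one_le_rpow (by linarith) (by positivity)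
    have hε : 0 < truncLevel s N := by unfold truncLevel; positivity
    have hεl : truncLevel s N ≤ l := (inv_le_one_of_one_le₀ h4l).trans hlog
    have hεs : truncLevel s N ^ s ≤ 1 / (4 * l) := by
      rw [truncLevel, Real.inv_rpow (by positivity), ← Real.rpow_mul (by positivity),
        one_div_mul_cancel hs.ne', Real.rpow_one, one_div]
    have hzl : 1 / z.im ≤ l := by
      rw [one_div]; exact inv_le_of_inv_le₀ hl0 hη
    have hn : 6 + 6 * d + 10 * d ^ 2 < N * d := by
      have : N * 1 ≤ N * d := by gcongr; omega
      omega
    have hinv : (N : ℝ) ^ (-100 : ℤ) ≤ 1 / N := by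
      rw [hpow, one_div]
      exact inv_anti₀ hN0 (le_self_pow₀ (by linarith) (by norm_num))
    have herr : l ^ s * deviationError N d t (s * l ^ s / truncLevel s N) l (1 / (16 * l))
        ≤ 1 / (8 * l) := by
      refine (mul_le_mul_of_nonneg_left (hdev.trans hinv) (by positivity)).trans ?_
      rw [mul_one_div, div_le_div_iff₀ hN0 (by positivity)]
      rw [Real.rpow_add_one hl0.ne'] at hlogN
      linarith
    refine le_trans ?_ (one_sub_le_law_real hs ht hz hzl hε hεl hεs hNd hn herr _)
    have h2 : (0 : ℝ) ≤ ((N₀ : ℝ) ^ 100 + 1) * (N : ℝ) ^ (-100 : ℤ) := by positivity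
    linarith
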